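/- Let $\mathcal{M}$ be the space of locally finite subsets of $\mathbb{R}$, equipped with the smallest $\sigma$-algebra for which all the maps $S \mapsto |S \cap B|$, with $B \subseteq \mathbb{R}$ Borel, are measurable; a Poisson process on $\mathbb{R}$ is viewed as a random element of $\mathcal{M}$. A map $f : \mathcal{M} \to \mathcal{M}$ is equivariant if it commutes with every shift of $\mathbb{R}$, i.e. $f(S + t) = f(S) + t$ for all $S \in \mathcal{M}$ and $t \in \mathbb{R}$. For $\lambda' > \lambda > 0$, a thickening from intensity $\lambda$ to intensity $\lambda'$ is a (deterministic) measurable map $f : \mathcal{M} \to \mathcal{M}$ such that, whenever $X$ is a Poisson process of intensity $\lambda$ on $\mathbb{R}$, the union $X \cup f(X)$ is a Poisson process of intensity $\lambda'$ on $\mathbb{R}$. Theorem. For every $\lambda' > \lambda > 0$ there exists a thickening from intensity $\lambda$ to intensity $\lambda'$ that is not equivariant. -/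

import Mathlib

open MeasureTheory ProbabilityTheory
open scoped NNReal ENNReal

/-- The space `𝓜` of locally finite subsets of the real line. -/
@[ext]
structure LocFinSet where
  /-- the underlying set of points -/
  carrier : Set ℝ
  finite_inter : ∀ K : Set ℝ, IsCompact K → (carrier ∩ K).Finite

namespace LocFinSet

/-- The number of points of `S` in `B`, an element of `{0, 1, 2, …, ∞}`. -/
noncomputable def count (B : Set ℝ) (S : LocFinSet) : ℕ∞ := (S.carrier ∩ B).encard

/-- The standard σ-algebra: the smallest one for which all the counting maps `count B`,
with `B` a Borel set, are measurable. -/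
noncomputable instance : MeasurableSpace LocFinSet :=
  ⨆ B : {B : Set ℝ // MeasurableSet B}, MeasurableSpace.comap (count B.1) ⊤

theorem measurable_count {B : Set ℝ} (hB : MeasurableSet B) : Measurable (count B) :=
  (comap_measurable (count B)).mono
    (le_iSup (fun B : {B : Set ℝ // MeasurableSet B} => MeasurableSpace.comap (count B.1) ⊤)
      ⟨B, hB⟩) le_rfl

/-- The union of two locally finite sets. -/
instance : Union LocFinSet where
  union S T :=
    { carrier := S.carrier ∪ T.carrier
      finite_inter := fun K hK => by
        rw [Set.union_inter_distrib_right]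
        exact (S.finite_inter K hK).union (T.finite_inter K hK) }

/-- The translate `S + t` of a locally finite set. -/
def shift (t : ℝ) (S : LocFinSet) : LocFinSet where
  carrier := (fun x => x + t) '' S.carrier
  finite_inter := fun K hK => by
    have h := (S.finite_inter ((fun x => x + -t) '' K)
      (hK.image (by fun_prop))).image (fun x => x + t)
    refine h.subset ?_
    rintro _ ⟨⟨x, hx, rfl⟩, hK'⟩
    exact ⟨x, ⟨hx, x + t, hK', by simp⟩, rfl⟩

end LocFinSet

/-- `μ` is the law of a (homogeneous) Poisson process of intensity `lam` on the real line: the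
number of points in a Borel set `B` of finite length `|B|` is Poisson distributed with mean
`lam * |B|`, and the numbers of points in finitely many pairwise disjoint such sets are
independent. -/
structure IsPoissonLaw (lam : ℝ) (μ : Measure LocFinSet) : Prop where
  isProbabilityMeasure : IsProbabilityMeasure μ
  map_count : ∀ B : Set ℝ, MeasurableSet B → volume B ≠ ∞ →
    μ.map (LocFinSet.count B) =
      (poissonMeasure (lam * volume.real B).toNNReal).map (fun n : ℕ => (n : ℕ∞))
  iIndepFun_count : ∀ (n : ℕ) (B : Fin n → Set ℝ), (∀ i, MeasurableSet (B i)) →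
    (∀ i, volume (B i) ≠ ∞) → Pairwise (fun i j => Disjoint (B i) (B j)) →
    iIndepFun (fun i => LocFinSet.count (B i)) μ

/-- A thickening from intensity `lam` to `lam'`: a measurable map `f` such that `X ∪ f(X)` is a
Poisson process of intensity `lam'` when `X` is a Poisson process of intensity `lam`.
Here `μ` is the law of `X`. -/
def IsThickening (lam lam' : ℝ) (f : LocFinSet → LocFinSet) : Prop :=
  Measurable f ∧ ∀ μ : Measure LocFinSet, IsPoissonLaw lam μ →
    IsPoissonLaw lam' (μ.map (fun S => S ∪ f S))

/-- `f` is equivariant if it commutes with all the shifts of the line. -/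
def IsEquivariant (f : LocFinSet → LocFinSet) : Prop :=
  ∀ (t : ℝ) (S : LocFinSet), f (S.shift t) = (f S).shift t

/-!
The line is cut into cells of a length `L` for which the mean number of points per cell is `m + 2`
and at least `2` points have to be added to each cell on average. In terms of cells, a Poisson
process is an i.i.d. family, indexed by the cells, of a Poisson number of points and a sequence of
uniform positions (`isPoissonLaw_cellConfigLaw`). The points that are added depend only on the
numbers of points in the cells. These play two parts at once: they enter the total numbers of points,
and they are the source of the randomness with which points are added.

For mean `m + 2` the counts `m + 1` and `m + 2` are equally likely. Let them encode the bits
`false` and `true`, and let all other counts be erasures. Reading a row of cells up to the first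
encoded bit gives a fair bit (`map_firstBit`), which however depends on the counts. The key point
is that this dependence can be repaired by the number of added points: given the number of points
`n` of a cell and the bit `b`, points are added according to a slightly perturbed Poisson law
(`addedLaw`), chosen so that the total number of points is Poisson of the larger mean *and
independent of the bit* (`map_nextBit_add`). Here `r ≥ 2` makes the perturbation a probability
measure. The bit passed on to the left is then at every cell independent of the outputs of this
cell and of all cells to its right, and so the outputs of a row of cells are i.i.d. and
independent of the bit that the row encodes. This is an instance of a general statement about
chains with a backward recursion (`chain_map_eq`).

The construction assumes auxiliary randomness to draw the added points and their positions. The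
cells are arranged in infinitely many blocks, each block consisting of infinitely many rows. The
rows of a block encode infinitely many independent fair bits, from which all the auxiliary
randomness of the preceding block is manufactured (`exists_measurable_map_fairCoin_eq`). Since a
thickened block is independent of its own bits (`map_thickenBlock`), these bits may be spent
elsewhere; a second application of `chain_map_eq`, to the chain of blocks, gives the law of the
whole (`map_thickenBlocks`, `exists_thickenCells`).

A thickening has to work for every measure that satisfies `IsPoissonLaw`; there is only one such
measure (`IsPoissonLaw.unique`), so that it suffices to look at the law of independent cells.

The map is not equivariant because it depends on the configuration only through the numbers of
points in the cells. These do not change when a configuration whose points stay away from the ends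
of the cells is moved a little, whereas by equivariance the added points would have to move along
(`not_isEquivariant_addedPoints`). Some configuration does receive points, as the intensity grows.
-/

/-! ### Infinite product measures -/

section InfiniteProducts

open Measure

variable {ι κ α β : Type*} [MeasurableSpace α] [MeasurableSpace β]

theorem nonempty_finiteSpanningSetsIn (μ : Measure α) [IsProbabilityMeasure μ]
    {D : Set (Set α)} (hD : Set.univ ∈ D) : Nonempty (μ.FiniteSpanningSetsIn D) :=
  ⟨⟨fun _ => Set.univ, fun _ => hD, fun _ => by simp, by simp [Set.iUnion_const]⟩⟩

/-- A measure on `α × (ι → β)` is the product of `μ` and an infinite product as soon as it has the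
right values on products of a set from a π-system generating `α` and a measurable box. -/
theorem prod_infinitePi_eq {μ : Measure α} [IsProbabilityMeasure μ] {ν : ι → Measure β}
    [∀ i, IsProbabilityMeasure (ν i)] {C : Set (Set α)}
    (hC : MeasurableSpace.generateFrom C = ‹_›) (hπ : IsPiSystem C) (huniv : Set.univ ∈ C)
    {ρ : Measure (α × (ι → β))}
    (h : ∀ s ∈ C, ∀ (I : Finset ι) (t : ι → Set β), (∀ i, MeasurableSet (t i)) →
      ρ (s ×ˢ (I : Set ι).pi t) = μ s * ∏ i ∈ I, ν i (t i)) :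
    μ.prod (infinitePi ν) = ρ := by
  have huniv' : (Set.univ : Set (ι → β)) ∈
      squareCylinders fun _ : ι => {s : Set β | MeasurableSet s} :=
    ⟨∅, fun _ => Set.univ, by simp [Set.mem_pi], by simp⟩
  refine Measure.prod_eq_generateFrom hC generateFrom_squareCylinders hπ
    (isPiSystem_squareCylinders (fun _ => MeasurableSpace.isPiSystem_measurableSet)
      (by simp)) (nonempty_finiteSpanningSetsIn μ huniv).some
    (nonempty_finiteSpanningSetsIn (infinitePi ν) huniv').some ?_
  rintro s hs _ ⟨I, t, ht, rfl⟩
  have ht' : ∀ i, MeasurableSet (t i) := fun i => ht i (Set.mem_univ i)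
  rw [h s hs I t ht', infinitePi_pi _ fun i _ => ht' i]

/-- Pairing two independent i.i.d. families coordinatewise gives an i.i.d. family of pairs. -/
theorem infinitePi_prod_map_unzip (μ : Measure α) [IsProbabilityMeasure μ] (ν : Measure β)
    [IsProbabilityMeasure ν] :
    (infinitePi fun _ : ι => μ.prod ν).map (fun f => (fun i => (f i).1, fun i => (f i).2)) =
      (infinitePi fun _ : ι => μ).prod (infinitePi fun _ : ι => ν) := by
  classical
  symm
  refine prod_infinitePi_eq (C := squareCylinders fun _ : ι => {s : Set α | MeasurableSet s})
    generateFrom_squareCylinders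
    (isPiSystem_squareCylinders (fun _ => MeasurableSpace.isPiSystem_measurableSet) (by simp))
    ⟨∅, fun _ => Set.univ, by simp [Set.mem_pi], by simp⟩ ?_
  rintro _ ⟨J, s, hs, rfl⟩ I t ht
  have hs' : ∀ i, MeasurableSet (s i) := fun i => hs i (Set.mem_univ i)
  rw [map_apply (by fun_prop) ((MeasurableSet.pi J.countable_toSet fun i _ => hs' i).prod
    (MeasurableSet.pi I.countable_toSet fun i _ => ht i)), infinitePi_pi _ fun i _ => hs' i]
  have : (fun f : ι → α × β => (fun i => (f i).1, fun i => (f i).2)) ⁻¹'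
      ((J : Set ι).pi s ×ˢ (I : Set ι).pi t) =
      ((J ∪ I : Finset ι) : Set ι).pi fun i =>
        (if i ∈ J then s i else Set.univ) ×ˢ (if i ∈ I then t i else Set.univ) := by
    ext f
    simp only [Set.mem_preimage, Set.mem_prod, Set.mem_pi, Finset.mem_coe, Finset.mem_union]
    constructor
    · rintro ⟨h1, h2⟩ i -
      constructor
      · split_ifs with h
        · exact h1 i h
        · trivial
      · split_ifs with h
        · exact h2 i h
        · trivial
    · intro h
      exact ⟨fun i hi => by simpa [hi] using (h i (Or.inl hi)).1,
        fun i hi => by simpa [hi] using (h i (Or.inr hi)).2⟩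
  rw [this, infinitePi_pi]
  · simp only [prod_prod, Finset.prod_mul_distrib]
    congr 1
    · rw [← Finset.prod_subset (Finset.subset_union_left (s₁ := J) (s₂ := I))]
      · exact Finset.prod_congr rfl fun i hi => by simp [hi]
      · intro i _ hi; simp [hi]
    · rw [← Finset.prod_subset (Finset.subset_union_right (s₁ := J) (s₂ := I))]
      · exact Finset.prod_congr rfl fun i hi => by simp [hi]
      · intro i _ hi; simp [hi]
  · intro i _
    refine MeasurableSet.prod ?_ ?_
    · split_ifs
      exacts [hs' i, MeasurableSet.univ]
    · split_ifs
      exacts [ht i, MeasurableSet.univ]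

theorem infinitePi_prod_map_zip (μ : Measure α) [IsProbabilityMeasure μ] (ν : Measure β)
    [IsProbabilityMeasure ν] :
    ((infinitePi fun _ : ι => μ).prod (infinitePi fun _ : ι => ν)).map
      (fun p i => (p.1 i, p.2 i)) = infinitePi fun _ : ι => μ.prod ν := by
  rw [← infinitePi_prod_map_unzip, map_map (by fun_prop) (by fun_prop)]
  exact map_id

theorem infinitePi_map_swap (μ : Measure α) [IsProbabilityMeasure μ] :
    (infinitePi fun _ : ι => infinitePi fun _ : κ => μ).map (fun f j i => f i j) =
      infinitePi fun _ : κ => infinitePi fun _ : ι => μ := by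
  rw [← infinitePi_map_curry (fun (_ : ι) (_ : κ) => μ),
    ← infinitePi_map_curry (fun (_ : κ) (_ : ι) => μ),
    ← map_infinitePi_infinitePi_of_inj (P := fun _ : ι × κ => μ) (f := Prod.swap)
      Prod.swap_injective, map_map (by fun_prop) (by fun_prop), map_map (by fun_prop) (by fun_prop)]
  rfl

/-- The head and the tail of an i.i.d. sequence are independent. -/
theorem infinitePi_map_head_tail (μ : Measure α) [IsProbabilityMeasure μ] :
    (infinitePi fun _ : ℕ => μ).map (fun f => (f 0, fun n => f (n + 1))) =
      μ.prod (infinitePi fun _ : ℕ => μ) := by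
  classical
  symm
  refine prod_infinitePi_eq (C := {s | MeasurableSet s}) MeasurableSpace.generateFrom_measurableSet
    MeasurableSpace.isPiSystem_measurableSet MeasurableSet.univ ?_
  intro s hs I t ht
  rw [map_apply (by fun_prop) (hs.prod (MeasurableSet.pi I.countable_toSet fun i _ => ht i))]
  have : (fun f : ℕ → α => (f 0, fun n => f (n + 1))) ⁻¹' (s ×ˢ (I : Set ℕ).pi t) =
      ((insert 0 (I.map (addRightEmbedding 1)) : Finset ℕ) : Set ℕ).pi
        (fun n => Nat.casesOn n s t) := by
    ext f
    simp [Set.mem_pi]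
  rw [this, infinitePi_pi]
  · rw [Finset.prod_insert (by simp), Finset.prod_map]
    rfl
  · rintro (_ | i) _
    exacts [hs, ht i]

/-- **Chains with a state.** Let `ζ₀, ζ₁, …` be i.i.d. with law `m`, and let the states
`yₙ = y (ζₙ, ζₙ₊₁, …)` satisfy the backward recursion `yₙ = T ζₙ yₙ₊₁`. If one step turns
independent `ζ ∼ m` and `y ∼ π` into independent `T ζ y ∼ π` and `Φ ζ y ∼ ν`, then the outputs
`Φ ζₙ yₙ₊₁` are i.i.d. with law `ν` and independent of the initial state. -/
theorem chain_map_eq {A S Z : Type*} [MeasurableSpace A] [MeasurableSpace S] [MeasurableSpace Z]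
    {m : Measure A} [IsProbabilityMeasure m] {π : Measure S} [IsProbabilityMeasure π]
    {ν : Measure Z} [IsProbabilityMeasure ν] {T : A → S → S} {Φ : A → S → Z}
    (hT : Measurable fun p : A × S => T p.1 p.2) (hΦ : Measurable fun p : A × S => Φ p.1 p.2)
    (hstep : (m.prod π).map (fun p => (T p.1 p.2, Φ p.1 p.2)) = π.prod ν)
    {y : (ℕ → A) → S} (hy : Measurable y) (hrec : ∀ ζ, y ζ = T (ζ 0) (y fun n => ζ (n + 1)))
    (hlaw : (infinitePi fun _ : ℕ => m).map y = π) :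
    (infinitePi fun _ : ℕ => m).map (fun ζ => (y ζ, fun n => Φ (ζ n) (y fun k => ζ (n + 1 + k)))) =
      π.prod (infinitePi fun _ : ℕ => ν) := by
  set P := infinitePi fun _ : ℕ => m with hP
  have hout : ∀ n, Measurable fun ζ : ℕ → A => Φ (ζ n) (y fun k => ζ (n + 1 + k)) := fun n =>
    hΦ.comp (f := fun ζ : ℕ → A => (ζ n, y fun k => ζ (n + 1 + k)))
      ((measurable_pi_apply n).prodMk
        (hy.comp (f := fun (ζ : ℕ → A) k => ζ (n + 1 + k)) (by fun_prop)))
  have key : ∀ (n : ℕ) (t : Set S) (s : ℕ → Set Z), MeasurableSet t → (∀ i, MeasurableSet (s i)) →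
      P {ζ | y ζ ∈ t ∧ ∀ i < n, Φ (ζ i) (y fun k => ζ (i + 1 + k)) ∈ s i} =
        π t * ∏ i ∈ Finset.range n, ν (s i) := by
    intro n
    induction n with
    | zero =>
      intro t s ht _
      simp only [not_lt_zero, IsEmpty.forall_iff, implies_true, and_true, Finset.range_zero,
        Finset.prod_empty, mul_one]
      rw [← hlaw, map_apply hy ht]
      rfl
    | succ n ih =>
      intro t s ht hs
      set E : Set (ℕ → A) :=
        {ζ | ∀ i < n, Φ (ζ i) (y fun k => ζ (i + 1 + k)) ∈ s (i + 1)} with hE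
      have hEm : MeasurableSet E := by
        have : E = ⋂ i ∈ Set.Iio n, (fun ζ : ℕ → A => Φ (ζ i) (y fun k => ζ (i + 1 + k))) ⁻¹'
            s (i + 1) := by ext; simp [hE]
        rw [this]
        exact MeasurableSet.biInter (Set.to_countable _) fun i _ => hout i (hs _)
      -- the event, written in terms of the head and the tail
      let F : Set (A × (ℕ → A)) :=
        {p | (T p.1 (y p.2) ∈ t ∧ Φ p.1 (y p.2) ∈ s 0) ∧ p.2 ∈ E}
      have hFm : MeasurableSet F := by
        have h1 : Measurable fun p : A × (ℕ → A) => (p.1, y p.2) :=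
          measurable_fst.prodMk (hy.comp measurable_snd)
        exact (((hT.comp h1) ht).inter ((hΦ.comp h1) (hs 0))).inter (measurable_snd hEm)
      have hpre : {ζ | y ζ ∈ t ∧ ∀ i < n + 1, Φ (ζ i) (y fun k => ζ (i + 1 + k)) ∈ s i} =
          (fun ζ : ℕ → A => (ζ 0, fun n => ζ (n + 1))) ⁻¹' F := by
        ext ζ
        have e0 : (fun k => ζ (0 + 1 + k)) = fun n => ζ (n + 1) := by
          funext k; congr 1; omega
        have e1 : ∀ i, (fun k => ζ (i + 1 + 1 + k)) = fun k => ζ (i + 1 + k + 1) := by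
          intro i; funext k; congr 1; omega
        simp only [Set.mem_ofPred_eq, Set.mem_preimage, F, E, hrec ζ, and_assoc]
        constructor
        · rintro ⟨h1, h2⟩
          refine ⟨h1, ?_, fun i hi => ?_⟩
          · simpa only [e0] using h2 0 (by omega)
          · simpa only [e1] using h2 (i + 1) (by omega)
        · rintro ⟨h1, h2, h3⟩
          refine ⟨h1, ?_⟩
          rintro (_ | i) hi
          · simpa only [e0] using h2
          · simpa only [e1] using h3 i (by omega)
      rw [hpre, ← map_apply (by fun_prop) hFm, infinitePi_map_head_tail, prod_apply hFm]
      have hslice : ∀ a : A, P (Prod.mk a ⁻¹' F) =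
          π (Prod.mk a ⁻¹' ((fun p : A × S => (T p.1 p.2, Φ p.1 p.2)) ⁻¹' (t ×ˢ s 0))) *
            ∏ i ∈ Finset.range n, ν (s (i + 1)) := by
        intro a
        rw [← ih _ (fun i => s (i + 1))
          (measurable_prodMk_left ((hT.prodMk hΦ) (ht.prod (hs 0)))) fun i => hs _]
        rfl
      simp only [← hP, hslice]
      rw [lintegral_mul_const _ (measurable_measure_prodMk_left
          ((hT.prodMk hΦ) (ht.prod (hs 0)))),
        ← prod_apply ((hT.prodMk hΦ) (ht.prod (hs 0))),
        ← map_apply (hT.prodMk hΦ) (ht.prod (hs 0)), hstep, prod_prod, Finset.prod_range_succ',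
        mul_assoc, mul_comm (ν (s 0))]
  classical
  symm
  refine prod_infinitePi_eq (C := {s | MeasurableSet s}) MeasurableSpace.generateFrom_measurableSet
    MeasurableSpace.isPiSystem_measurableSet MeasurableSet.univ ?_
  intro t ht I s hs
  have hm : Measurable fun ζ : ℕ → A => (y ζ, fun n => Φ (ζ n) (y fun k => ζ (n + 1 + k))) :=
    hy.prodMk (measurable_pi_lambda _ hout)
  rw [map_apply hm (ht.prod (MeasurableSet.pi I.countable_toSet fun i _ => hs i))]
  obtain ⟨N, hN⟩ := I.exists_nat_subset_range
  have h := key N t (fun i => if i ∈ I then s i else Set.univ) ht fun i => by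
    split_ifs
    exacts [hs i, MeasurableSet.univ]
  have hprod : ∏ i ∈ Finset.range N, ν (if i ∈ I then s i else Set.univ) = ∏ i ∈ I, ν (s i) := by
    rw [← Finset.prod_subset hN]
    · exact Finset.prod_congr rfl fun i hi => by simp [hi]
    · intro i _ hi; simp [hi]
  rw [hprod] at h
  rw [← h]
  congr 1
  ext ζ
  simp only [Set.mem_preimage, Set.mem_prod, Set.mem_pi, Finset.mem_coe, Set.mem_ofPred_eq]
  refine and_congr_right fun _ => ⟨fun h i _ => ?_, fun h i hi => ?_⟩
  · split_ifs with hi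
    exacts [h i hi, trivial]
  · simpa [hi] using h i (Finset.mem_range.1 (hN hi))

end InfiniteProducts

/-! ### From fair bits to arbitrary randomness -/

section FairBits

open Measure Filter Topology

/-- The law of a fair coin. -/
noncomputable def fairCoin : Measure Bool :=
  (2⁻¹ : ℝ≥0∞) • dirac false + (2⁻¹ : ℝ≥0∞) • dirac true

instance : IsProbabilityMeasure fairCoin :=
  ⟨by simp [fairCoin, ENNReal.inv_two_add_inv_two]⟩

theorem integral_fairCoin (g : Bool → ℂ) :
    ∫ b, g b ∂fairCoin = (g false + g true) / 2 := by
  rw [fairCoin, integral_add_measure (Integrable.of_finite.smul_measure (by simp))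
      (Integrable.of_finite.smul_measure (by simp)),
    integral_smul_measure, integral_smul_measure, integral_dirac, integral_dirac]
  simp
  ring

/-- The uniform distribution on `[0, 1)`, as a measure on `ℝ`. -/
noncomputable def unif : Measure ℝ := volume.restrict (Set.Ico 0 1)

instance : IsProbabilityMeasure unif := ⟨by simp [unif]⟩

/-- A law on `ℝ` that is self-similar under `x ↦ x / 2` and `x ↦ (1 + x) / 2` is determined by this
property, here expressed through characteristic functions: iterating the functional equation
compares the two characteristic functions at arguments tending to `0`. -/
theorem eq_of_charFun_selfSimilar {μ ν : Measure ℝ} [IsProbabilityMeasure μ]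
    [IsProbabilityMeasure ν]
    (hμ : ∀ t : ℝ, charFun μ t = (1 + Complex.exp ((t / 2 : ℝ) * Complex.I)) / 2 *
      charFun μ (t / 2))
    (hν : ∀ t : ℝ, charFun ν t = (1 + Complex.exp ((t / 2 : ℝ) * Complex.I)) / 2 *
      charFun ν (t / 2)) : μ = ν := by
  refine Measure.ext_of_charFun (funext fun t => ?_)
  have step : ∀ t : ℝ, ‖charFun μ t - charFun ν t‖ ≤
      ‖charFun μ (t / 2) - charFun ν (t / 2)‖ := by
    intro t
    rw [hμ, hν, ← mul_sub, norm_mul]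
    refine mul_le_of_le_one_left (norm_nonneg _) ?_
    rw [norm_div, Complex.norm_ofNat, div_le_one (by norm_num)]
    refine (norm_add_le _ _).trans ?_
    rw [Complex.norm_exp_ofReal_mul_I, norm_one]
    norm_num
  have iter : ∀ n : ℕ, ‖charFun μ t - charFun ν t‖ ≤
      ‖charFun μ (t * (1 / 2) ^ n) - charFun ν (t * (1 / 2) ^ n)‖ := by
    intro n
    induction n with
    | zero => simp
    | succ n ih =>
      refine ih.trans ((step _).trans (le_of_eq ?_))
      congr 3 <;> ring
  have hlim : Tendsto (fun n : ℕ => t * (1 / 2 : ℝ) ^ n) atTop (𝓝 0) := by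
    simpa using (tendsto_pow_atTop_nhds_zero_of_lt_one (by norm_num : (0 : ℝ) ≤ 1 / 2)
      (by norm_num)).const_mul t
  have hc : Tendsto (fun n : ℕ => ‖charFun μ (t * (1 / 2) ^ n) - charFun ν (t * (1 / 2) ^ n)‖) atTop
      (𝓝 ‖charFun μ 0 - charFun ν 0‖) :=
    (((continuous_charFun (μ := μ)).sub (continuous_charFun (μ := ν))).norm.tendsto 0).comp hlim
  have h0 : ‖charFun μ t - charFun ν t‖ ≤ 0 := by
    have := ge_of_tendsto' hc iter
    simpa [charFun_zero] using this
  exact sub_eq_zero.1 (norm_le_zero_iff.1 h0)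

theorem charFun_unif_selfSimilar (t : ℝ) :
    charFun unif t = (1 + Complex.exp ((t / 2 : ℝ) * Complex.I)) / 2 * charFun unif (t / 2) := by
  have h : ∀ s : ℝ, charFun unif s = ∫ x in (0 : ℝ)..1, Complex.exp (s * x * Complex.I) := by
    intro s
    rw [charFun_apply_real, unif, integral_Ico_eq_integral_Ioc,
      ← intervalIntegral.integral_of_le zero_le_one]
  have hc : Continuous fun x : ℝ => Complex.exp (t * x * Complex.I) := by fun_prop
  rw [h, h, ← intervalIntegral.integral_add_adjacent_intervals
    (hc.intervalIntegrable 0 (1 / 2)) (hc.intervalIntegrable (1 / 2) 1)]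
  have h1 := intervalIntegral.integral_comp_div (a := 0) (b := 1)
    (fun x : ℝ => Complex.exp (t * x * Complex.I)) (two_ne_zero' ℝ)
  have h2 := intervalIntegral.integral_comp_add_div (a := 0) (b := 1)
    (fun x : ℝ => Complex.exp (t * x * Complex.I)) (two_ne_zero' ℝ) (1 / 2)
  have e1 : (∫ x in (0 : ℝ)..1, Complex.exp (t * (x / 2 : ℝ) * Complex.I)) =
      ∫ x in (0 : ℝ)..1, Complex.exp ((t / 2 : ℝ) * x * Complex.I) := by
    congr 1; funext x; push_cast; ring_nf
  have e2 : (∫ x in (0 : ℝ)..1, Complex.exp (t * (1 / 2 + x / 2 : ℝ) * Complex.I)) =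
      Complex.exp ((t / 2 : ℝ) * Complex.I) *
        ∫ x in (0 : ℝ)..1, Complex.exp ((t / 2 : ℝ) * x * Complex.I) := by
    rw [← intervalIntegral.integral_const_mul]
    congr 1; funext x; rw [← Complex.exp_add]; push_cast; ring_nf
  rw [e1] at h1
  rw [e2] at h2
  norm_num at h1 h2
  norm_num
  linear_combination (-1 / 2 : ℂ) * h1 + (-1 / 2 : ℂ) * h2

/-- The real number in `[0, 1]` with the given binary digits. -/
noncomputable def binaryReal (b : ℕ → Bool) : ℝ :=
  ∑' n, (if b n then 1 else 0) * (1 / 2 : ℝ) ^ (n + 1)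

theorem summable_binaryReal (b : ℕ → Bool) :
    Summable fun n => (if b n then 1 else 0) * (1 / 2 : ℝ) ^ (n + 1) := by
  refine Summable.of_nonneg_of_le (fun n => by positivity) (fun n => ?_)
    ((summable_nat_add_iff 1).2 (summable_geometric_two))
  split_ifs <;> simp

theorem binaryReal_eq (b : ℕ → Bool) :
    binaryReal b = ((if b 0 then 1 else 0) + binaryReal fun n => b (n + 1)) / 2 := by
  rw [binaryReal, (summable_binaryReal b).tsum_eq_zero_add, binaryReal, add_div, ← tsum_div_const]
  congr 1
  · split_ifs <;> simp
  · exact tsum_congr fun n => by ring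

theorem measurable_binaryReal : Measurable binaryReal := by
  refine measurable_of_tendsto_metrizable (f := fun n b => ∑ i ∈ Finset.range n,
    (if b i then 1 else 0) * (1 / 2 : ℝ) ^ (i + 1)) (fun n => ?_) (tendsto_pi_nhds.2 fun b =>
      (summable_binaryReal b).hasSum.tendsto_sum_nat)
  refine Finset.measurable_fun_sum _ fun i _ => ?_
  have : Measurable fun c : Bool => (if c then (1 : ℝ) else 0) := Measurable.of_discrete
  exact (this.comp (measurable_pi_apply i)).mul_const _

/-- Fair bits are the binary digits of a uniform random number. -/
theorem map_binaryReal : (infinitePi fun _ : ℕ => fairCoin).map binaryReal = unif := by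
  have : IsProbabilityMeasure ((infinitePi fun _ : ℕ => fairCoin).map binaryReal) :=
    isProbabilityMeasure_map measurable_binaryReal.aemeasurable
  refine eq_of_charFun_selfSimilar (fun t => ?_) charFun_unif_selfSimilar
  set P := infinitePi fun _ : ℕ => fairCoin with hP
  have hb : Measurable fun c : Bool => (if c then (1 : ℝ) else 0) := Measurable.of_discrete
  have hstep : Measurable fun p : Bool × (ℕ → Bool) =>
      ((if p.1 then 1 else 0) + binaryReal p.2) / 2 :=
    ((hb.comp measurable_fst).add (measurable_binaryReal.comp measurable_snd)).div_const 2
  have hlaw : P.map binaryReal = (fairCoin.prod P).map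
      fun p => ((if p.1 then 1 else 0) + binaryReal p.2) / 2 := by
    rw [hP, ← infinitePi_map_head_tail, map_map hstep (by fun_prop)]
    congr 1
    funext b
    exact binaryReal_eq b
  have hl := congrArg (fun μ => charFun μ t) hlaw
  rw [hl, charFun_apply_real, charFun_apply_real, integral_map hstep.aemeasurable (by fun_prop),
    integral_map measurable_binaryReal.aemeasurable (by fun_prop)]
  have e : ∀ p : Bool × (ℕ → Bool),
      Complex.exp (t * (((if p.1 then 1 else 0) + binaryReal p.2) / 2 : ℝ) * Complex.I) =
        Complex.exp (((t / 2 : ℝ) * (if p.1 then 1 else 0)) * Complex.I) *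
          Complex.exp ((t / 2 : ℝ) * binaryReal p.2 * Complex.I) := by
    intro p
    rw [← Complex.exp_add]
    congr 1
    push_cast
    split_ifs <;> push_cast <;> ring
  -- the first bit is independent of the others
  rw [integral_congr_ae (ae_of_all _ e)]
  rw [integral_prod_mul (fun c : Bool =>
    Complex.exp (((t / 2 : ℝ) * (if c then 1 else 0)) * Complex.I)) fun b : ℕ → Bool =>
    Complex.exp ((t / 2 : ℝ) * binaryReal b * Complex.I), integral_fairCoin]
  simp

/-- Every law on a standard Borel space is the law of a function of a sequence of fair bits. -/
theorem exists_measurable_map_fairCoin_eq {Y : Type*} [MeasurableSpace Y] [StandardBorelSpace Y]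
    (μ : Measure Y) [IsProbabilityMeasure μ] :
    ∃ V : (ℕ → Bool) → Y, Measurable V ∧ (infinitePi fun _ : ℕ => fairCoin).map V = μ := by
  have : Nonempty Y := by
    by_contra h
    rw [not_nonempty_iff] at h
    exact IsProbabilityMeasure.ne_zero μ (Measure.eq_zero_of_isEmpty μ)
  obtain ⟨f, hf, hfμ⟩ := Measure.exists_measurable_map_eq μ
  have hproj : Measurable (Set.projIcc (0 : ℝ) 1 zero_le_one) := continuous_projIcc.measurable
  refine ⟨fun b => f (Set.projIcc 0 1 zero_le_one (binaryReal b)),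
    hf.comp (hproj.comp measurable_binaryReal), ?_⟩
  have h1 : unif.map (Set.projIcc (0 : ℝ) 1 zero_le_one) = volume := by
    have hv : (volume : Measure unitInterval).map Subtype.val = unif := by
      rw [unif, Measure.restrict_congr_set Ico_ae_eq_Icc]
      exact map_comap_subtype_coe measurableSet_Icc _
    rw [← hv, map_map hproj measurable_subtype_coe]
    convert Measure.map_id
    funext x
    simp
  rw [← hfμ, ← h1, ← map_binaryReal, map_map hproj measurable_binaryReal,
    map_map hf (hproj.comp measurable_binaryReal)]
  rfl

end FairBits

/-! ### Reading a bit from Poisson counts -/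

section Bits

open Measure

/-- The bit after reading the count `n`: the counts `m + 1` and `m + 2` encode the bits `false` and
`true`, every other count is an erasure and leaves the bit `b` as it is. -/
def nextBit (m n : ℕ) (b : Bool) : Bool :=
  if n = m + 1 then false else if n = m + 2 then true else b

open scoped Classical in
/-- The first bit encoded by a sequence of counts, where `m + 1` stands for `false` and `m + 2` for
`true`. It is `false` if no bit is encoded at all. -/
noncomputable def firstBit (m : ℕ) (x : ℕ → ℕ) : Bool :=
  decide (∃ n, x n = m + 2 ∧ ∀ k < n, x k ≠ m + 1 ∧ x k ≠ m + 2)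

theorem firstBit_eq_true_iff {m : ℕ} {x : ℕ → ℕ} :
    firstBit m x = true ↔ ∃ n, x n = m + 2 ∧ ∀ k < n, x k ≠ m + 1 ∧ x k ≠ m + 2 := by
  simp [firstBit]

theorem firstBit_eq (m : ℕ) (x : ℕ → ℕ) :
    firstBit m x = nextBit m (x 0) (firstBit m fun n => x (n + 1)) := by
  rw [Bool.eq_iff_iff, firstBit_eq_true_iff, nextBit]
  split_ifs with h1 h2
  · simp only [iff_false]
    rintro ⟨n, hn, hk⟩
    rcases n with _ | n
    · omega
    · exact (hk 0 (by omega)).1 h1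
  · simp only [iff_true]
    exact ⟨0, h2, by simp⟩
  · rw [firstBit_eq_true_iff]
    constructor
    · rintro ⟨n, hn, hk⟩
      rcases n with _ | n
      · exact absurd hn h2
      · exact ⟨n, hn, fun k hkn => hk (k + 1) (by omega)⟩
    · rintro ⟨n, hn, hk⟩
      refine ⟨n + 1, hn, ?_⟩
      rintro (_ | k) hkn
      exacts [⟨h1, h2⟩, hk k (by omega)]

theorem measurable_firstBit (m : ℕ) : Measurable (firstBit m) := by
  refine measurable_to_bool ?_
  have : firstBit m ⁻¹' {true} = ⋃ n, ({x : ℕ → ℕ | x n = m + 2} ∩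
      ⋂ k ∈ Set.Iio n, {x : ℕ → ℕ | x k ≠ m + 1 ∧ x k ≠ m + 2}) := by
    ext x
    simp [firstBit_eq_true_iff]
  rw [this]
  refine MeasurableSet.iUnion fun n => MeasurableSet.inter ?_ ?_
  · exact measurable_pi_apply (X := fun _ : ℕ => ℕ) n (MeasurableSet.of_discrete (s := {m + 2}))
  · refine MeasurableSet.biInter (Set.to_countable _) fun k _ => ?_
    exact measurable_pi_apply (X := fun _ : ℕ => ℕ) k
      (MeasurableSet.of_discrete (s := {j : ℕ | j ≠ m + 1 ∧ j ≠ m + 2}))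

/-- If both encoding counts are equally likely, then the first bit encoded by an i.i.d. sequence of
counts is fair: by the recursion `firstBit_eq`, the probability `q` of `true` satisfies
`q = p + (1 - 2 p) q`. -/
theorem map_firstBit {m : ℕ} {μ : Measure ℕ} [IsProbabilityMeasure μ]
    (h : μ.real {m + 1} = μ.real {m + 2}) (h0 : μ.real {m + 2} ≠ 0) :
    (infinitePi fun _ : ℕ => μ).map (firstBit m) = fairCoin := by
  set P := infinitePi fun _ : ℕ => μ with hP
  have hm := measurable_firstBit m
  have : IsProbabilityMeasure (P.map (firstBit m)) := isProbabilityMeasure_map hm.aemeasurable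
  set E : Set (ℕ → ℕ) := firstBit m ⁻¹' {true} with hE
  have hEm : MeasurableSet E := hm (MeasurableSet.of_discrete)
  have hrec : P.real E = μ.real {m + 2} + (1 - 2 * μ.real {m + 2}) * P.real E := by
    have hpre : E = (fun x : ℕ → ℕ => (x 0, fun n => x (n + 1))) ⁻¹'
        (({m + 2} : Set ℕ) ×ˢ Set.univ ∪ ({m + 1, m + 2} : Set ℕ)ᶜ ×ˢ E) := by
      ext x
      simp only [hE, Set.mem_preimage, Set.mem_singleton_iff, Set.mem_union, Set.mem_prod,
        Set.mem_univ, and_true, Set.mem_compl_iff, Set.mem_insert_iff]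
      rw [firstBit_eq, nextBit]
      split_ifs with h1 h2
      · simp [h1]
      · simp [h2]
      · simp [h1, h2]
    have hU : MeasurableSet
        (({m + 2} : Set ℕ) ×ˢ Set.univ ∪ ({m + 1, m + 2} : Set ℕ)ᶜ ×ˢ E) :=
      (MeasurableSet.of_discrete.prod MeasurableSet.univ).union
        (MeasurableSet.of_discrete.prod hEm)
    have hPE : P.real E = (μ.prod P).real
        (({m + 2} : Set ℕ) ×ˢ Set.univ ∪ ({m + 1, m + 2} : Set ℕ)ᶜ ×ˢ E) := by
      conv_lhs => rw [hpre]
      rw [← infinitePi_map_head_tail, map_measureReal_apply (by fun_prop) hU]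
    have hpair : μ.real ({m + 1, m + 2} : Set ℕ)ᶜ = 1 - 2 * μ.real {m + 2} := by
      rw [probReal_compl_eq_one_sub (MeasurableSet.of_discrete), Set.insert_eq,
        measureReal_union (by simp) (MeasurableSet.of_discrete), h]
      ring
    rw [measureReal_union _ (MeasurableSet.of_discrete.prod hEm), measureReal_prod_prod,
      measureReal_prod_prod, hpair] at hPE
    · simpa using hPE
    · rw [Set.disjoint_left]
      rintro ⟨a, x⟩ ⟨h1, -⟩ ⟨h2, -⟩
      exact h2 (Or.inr h1)
  have hq : P.real E = 1 / 2 := by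
    have : μ.real {m + 2} * (P.real E - 1 / 2) = 0 := by linarith
    rcases mul_eq_zero.1 this with h' | h'
    · exact absurd h' h0
    · linarith
  have htrue : (P.map (firstBit m)).real {true} = 1 / 2 := by
    rw [map_measureReal_apply hm (MeasurableSet.of_discrete), ← hE, hq]
  have hfalse : (P.map (firstBit m)).real {false} = 1 / 2 := by
    have : ({false} : Set Bool) = {true}ᶜ := by ext b; cases b <;> simp
    rw [this, probReal_compl_eq_one_sub (MeasurableSet.of_discrete), htrue]
    norm_num
  refine Measure.ext_of_singleton fun b => ?_
  rw [← measureReal_eq_measureReal_iff (by simp) (by simp)]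
  cases b
  · rw [hfalse]; simp [fairCoin, measureReal_def]
  · rw [htrue]; simp [fairCoin, measureReal_def]

end Bits

/-! ### Thickening the counts of one cell -/

section OneCell

open Measure

/-- The law of the number of points added to a cell with `n` points in which the bit is `b`. It is a
perturbation of `ρ` (the Poisson law of mean `r`) that makes up for the influence of the bit on the
number of points: a cell with `m + 1` points has bit `false`, a cell with `m + 2` points has bit
`true`. With bit `false` the missing cells with `m + 2` points are imitated by cells with `m + 1`
points, which with probability `1 / 2` receive one point more; with bit `true` the missing cells
with `m + 1` points are imitated by cells with `m + 2` points that receive one point less. When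
there is no point to be taken away, this fails: with bit `true` a total of `m + 1` points arises
less often than it should, and this is compensated in the cells with `m` points, where two added
points are sometimes reduced to one. -/
noncomputable def addedLaw (ρ : Measure ℕ) (θ : ℝ≥0∞) (m n : ℕ) : Bool → Measure ℕ
  | false => if n = m + 1 then (2⁻¹ : ℝ≥0∞) • ρ + (2⁻¹ : ℝ≥0∞) • ρ.map (· + 1) else ρ
  | true =>
    if n = m + 2 then (2⁻¹ : ℝ≥0∞) • ρ + (2⁻¹ : ℝ≥0∞) • ρ.map Nat.pred
    else if n = m then (1 - θ) • ρ + θ • ρ.map fun k => if k = 2 then 1 else k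
    else ρ

theorem isProbabilityMeasure_addedLaw (ρ : Measure ℕ) [IsProbabilityMeasure ρ] {θ : ℝ≥0∞}
    (hθ : θ ≤ 1) (m n : ℕ) (b : Bool) : IsProbabilityMeasure (addedLaw ρ θ m n b) := by
  have h : ∀ f : ℕ → ℕ, (ρ.map f) Set.univ = 1 := fun f => by
    rw [map_apply Measurable.of_discrete MeasurableSet.univ]; simp
  constructor
  cases b <;> simp only [addedLaw] <;> split_ifs <;>
    simp [h, ENNReal.inv_two_add_inv_two, tsub_add_cancel_of_le hθ]

/-- The images of `ρ` under two functions that differ only at `j` differ only by the mass of `j`. -/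
theorem measureReal_map_ite {ρ : Measure ℕ} [IsProbabilityMeasure ρ] (f g : ℕ → ℕ) (j : ℕ)
    (hfg : ∀ k, k ≠ j → f k = g k) (A : Set ℕ) :
    ρ.real (f ⁻¹' A) + ρ.real {j} * A.indicator 1 (g j) =
      ρ.real (g ⁻¹' A) + ρ.real {j} * A.indicator 1 (f j) := by
  have split : ∀ h : ℕ → ℕ, ρ.real (h ⁻¹' A) =
      ρ.real ((h ⁻¹' A) \ {j}) + ρ.real {j} * A.indicator 1 (h j) := by
    intro h
    rw [← measureReal_inter_add_sdiff (s := h ⁻¹' A) (t := {j}) MeasurableSet.of_discrete, add_comm]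
    congr 1
    by_cases hj : h j ∈ A
    · rw [Set.inter_eq_right.2 (by simpa using hj)]; simp [hj]
    · have : h ⁻¹' A ∩ {j} = ∅ := by
        ext k
        simp only [Set.mem_inter_iff, Set.mem_preimage, Set.mem_singleton_iff,
          Set.mem_empty_iff_false, iff_false, not_and]
        rintro hk rfl
        exact hj hk
      simp [this, hj]
  have : (f ⁻¹' A) \ {j} = (g ⁻¹' A) \ {j} := by
    ext k
    simp only [Set.mem_sdiff, Set.mem_preimage, Set.mem_singleton_iff]
    constructor <;> rintro ⟨h1, h2⟩ <;> refine ⟨?_, h2⟩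
    · rwa [← hfg k h2]
    · rwa [hfg k h2]
  rw [split f, split g, this]
  ring

/-- Consecutive Poisson probabilities: `m + 1` and `m + 2` are equally likely for mean `m + 2`. -/
theorem poissonMeasure_real_succ (m : ℕ) :
    (poissonMeasure (m + 2)).real {m + 1} = (poissonMeasure (m + 2)).real {m} *
        ((m + 2) / (m + 1)) ∧
      (poissonMeasure (m + 2)).real {m + 2} = (poissonMeasure (m + 2)).real {m + 1} := by
  simp only [poissonMeasure_real_singleton, Nat.factorial_succ]
  have h : (0 : ℝ) < m.factorial := by exact_mod_cast m.factorial_pos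
  push_cast
  constructor
  · field_simp
    ring
  · field_simp
    ring

/-- The probability that two added points are reduced to one in a cell with `m` points. -/
noncomputable def reduceProb (m : ℕ) (r : ℝ≥0) : ℝ := 2 * (m + 2) / ((m + 1) * r ^ 2)

theorem reduceProb_nonneg (m : ℕ) (r : ℝ≥0) : 0 ≤ reduceProb m r := by
  unfold reduceProb; positivity

theorem reduceProb_le_one (m : ℕ) {r : ℝ≥0} (hr : 2 ≤ r) : reduceProb m r ≤ 1 := by
  have hr' : (2 : ℝ) ≤ r := by exact_mod_cast hr
  unfold reduceProb
  rw [div_le_one (by positivity)]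
  have hm : (0 : ℝ) ≤ m := m.cast_nonneg
  nlinarith [mul_nonneg (by positivity : (0 : ℝ) ≤ m + 1)
    (by nlinarith : (0 : ℝ) ≤ (r : ℝ) ^ 2 - 4)]

theorem fairCoin_real_nextBit (m n : ℕ) (c : Bool) :
    fairCoin.real {b | nextBit m n b = c} =
      if n = m + 1 then (if c then 0 else 1) else if n = m + 2 then (if c then 1 else 0)
      else 2⁻¹ := by
  have h : ∀ s : Set Bool,
      fairCoin.real s = 2⁻¹ * s.indicator 1 false + 2⁻¹ * s.indicator 1 true := by
    intro s
    have hfin : ∀ b : Bool, ((2⁻¹ : ℝ≥0∞) • dirac b) s ≠ ∞ := fun b => by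
      rw [Measure.smul_apply, smul_eq_mul]
      exact ENNReal.mul_ne_top (by simp) (measure_ne_top _ _)
    rw [fairCoin, measureReal_add_apply (hfin _) (hfin _), measureReal_ennreal_smul_apply,
      measureReal_ennreal_smul_apply]
    by_cases h0 : false ∈ s <;> by_cases h1 : true ∈ s <;> simp [measureReal_def, h0, h1]
  rw [h]
  cases c <;> simp [nextBit, Set.indicator_apply] <;> split_ifs <;> simp_all <;> norm_num

/-- The contribution of the counts for which the number of added points is perturbed. -/
theorem sum_addedLaw_real (m : ℕ) {r : ℝ≥0} (hr : 2 ≤ r) (c : Bool) (A : Set ℕ) :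
    ∑ n ∈ {m, m + 1, m + 2}, (poissonMeasure (m + 2)).real {n} *
      fairCoin.real {b | nextBit m n b = c} *
        (addedLaw (poissonMeasure r) (ENNReal.ofReal (reduceProb m r)) m n c).real
          ((n + ·) ⁻¹' A) =
    ∑ n ∈ {m, m + 1, m + 2}, 2⁻¹ * ((poissonMeasure (m + 2)).real {n} *
      (poissonMeasure r).real ((n + ·) ⁻¹' A)) := by
  obtain ⟨h1, h2⟩ := poissonMeasure_real_succ m
  set p := (poissonMeasure (m + 2)).real {m} with hp
  set ρ := poissonMeasure r with hρ
  have hr' : (2 : ℝ) ≤ r := by exact_mod_cast hr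
  have hρ2 : ρ.real {2} = ρ.real {0} * (r ^ 2 / 2) := by
    simp [hρ, poissonMeasure_real_singleton]
    ring
  have hfin : ∀ s : Set ℕ, ρ s ≠ ∞ := fun s => measure_ne_top ρ s
  have hmap : ∀ (f : ℕ → ℕ) (s : Set ℕ), (ρ.map f).real s = ρ.real (f ⁻¹' s) := fun f s =>
    map_measureReal_apply Measurable.of_discrete MeasurableSet.of_discrete
  have hmapfin : ∀ (f : ℕ → ℕ) (s : Set ℕ), ρ.map f s ≠ ∞ := fun f s => by
    rw [map_apply Measurable.of_discrete MeasurableSet.of_discrete]; exact hfin _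
  have hhalf : ∀ (f : ℕ → ℕ) (s : Set ℕ),
      ((2⁻¹ : ℝ≥0∞) • ρ + (2⁻¹ : ℝ≥0∞) • ρ.map f).real s =
        2⁻¹ * ρ.real s + 2⁻¹ * ρ.real (f ⁻¹' s) := by
    intro f s
    rw [measureReal_add_apply (by simp [ENNReal.mul_eq_top, hfin])
      (by simp [ENNReal.mul_eq_top, hmapfin]), measureReal_ennreal_smul_apply,
      measureReal_ennreal_smul_apply, hmap]
    simp
  rw [Finset.sum_insert (by simp), Finset.sum_insert (by simp), Finset.sum_singleton,
    Finset.sum_insert (by simp), Finset.sum_insert (by simp), Finset.sum_singleton]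
  simp only [fairCoin_real_nextBit]
  cases c
  · have e : (fun k => k + 1) ⁻¹' ((fun k => m + 1 + k) ⁻¹' A) = (fun k => m + 2 + k) ⁻¹' A := by
      ext k; simp [show m + 1 + (k + 1) = m + 2 + k by omega]
    simp [addedLaw, hhalf, h2, e]
    ring
  · have hθ0 := reduceProb_nonneg m r
    have hθ1 := reduceProb_le_one m hr
    have hmix : ∀ (f : ℕ → ℕ) (s : Set ℕ),
        ((1 - ENNReal.ofReal (reduceProb m r)) • ρ +
          ENNReal.ofReal (reduceProb m r) • ρ.map f).real s =
        (1 - reduceProb m r) * ρ.real s + reduceProb m r * ρ.real (f ⁻¹' s) := by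
      intro f s
      rw [measureReal_add_apply (by simp [ENNReal.mul_eq_top, hfin])
        (by simp [ENNReal.mul_eq_top, hmapfin]), measureReal_ennreal_smul_apply,
        measureReal_ennreal_smul_apply, hmap, ENNReal.toReal_ofReal hθ0,
        ENNReal.toReal_sub_of_le (by simpa using hθ1) (by simp), ENNReal.toReal_ofReal hθ0]
      simp
    have k1 := measureReal_map_ite (ρ := ρ) (fun k => m + (if k = 2 then 1 else k)) (m + ·) 2
      (by intro k hk; simp [hk]) A
    have k2 := measureReal_map_ite (ρ := ρ) (fun k => m + 2 + Nat.pred k) (m + 1 + ·) 0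
      (by intro k hk; simp only [Nat.pred_eq_sub_one]; omega) A
    have e1 : (fun k => if k = 2 then 1 else k) ⁻¹' ((fun k => m + k) ⁻¹' A) =
        (fun k => m + (if k = 2 then 1 else k)) ⁻¹' A := rfl
    have e2 : Nat.pred ⁻¹' ((fun k => m + 2 + k) ⁻¹' A) = (fun k => m + 2 + Nat.pred k) ⁻¹' A := rfl
    simp [addedLaw, hhalf, hmix, h2, e1, e2] at k1 k2 ⊢
    rw [hρ2] at k1
    have hθ : reduceProb m r * (r ^ 2 / 2) = (m + 2) / (m + 1) := by
      unfold reduceProb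
      field_simp
    rw [h1]
    rw [← hθ]
    -- `k1` is the trade of a total of `m + 2` for `m + 1` in the cells with `m` points, and `k2`
    -- the opposite trade in the cells with `m + 2` points to which none is added
    linear_combination (p * reduceProb m r / 2) * k1 + (p * reduceProb m r * r ^ 2 / 4) * k2

/-- With added points drawn from `addedLaw`, the total number of points of a cell is Poisson of mean
`m + 2 + r`, independently of the bit. -/
theorem tsum_addedLaw (m : ℕ) {r : ℝ≥0} (hr : 2 ≤ r) (c : Bool) (A : Set ℕ) :
    ∑' n, poissonMeasure (m + 2) {n} * (fairCoin {b | nextBit m n b = c} *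
      addedLaw (poissonMeasure r) (ENNReal.ofReal (reduceProb m r)) m n c ((n + ·) ⁻¹' A)) =
    2⁻¹ * poissonMeasure (m + 2 + r) A := by
  have hκ : ∀ n, IsProbabilityMeasure
      (addedLaw (poissonMeasure r) (ENNReal.ofReal (reduceProb m r)) m n c) := fun n =>
    isProbabilityMeasure_addedLaw _ (by simpa using reduceProb_le_one m hr) _ _ _
  have hconv : poissonMeasure (m + 2 + r) A =
      ∑' n, poissonMeasure (m + 2) {n} * poissonMeasure r ((n + ·) ⁻¹' A) := by
    rw [← poissonMeasure_conv_poissonMeasure, Measure.conv,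
      map_apply Measurable.of_discrete MeasurableSet.of_discrete,
      prod_apply MeasurableSet.of_discrete, lintegral_countable']
    exact tsum_congr fun n => mul_comm _ _
  rw [hconv, ← ENNReal.tsum_mul_left, ← ENNReal.sum_add_tsum_compl {m, m + 1, m + 2},
    ← ENNReal.sum_add_tsum_compl {m, m + 1, m + 2} fun n => 2⁻¹ * _]
  congr 1
  · have h := congrArg ENNReal.ofReal (sum_addedLaw_real m hr c A)
    rw [ENNReal.ofReal_sum_of_nonneg fun _ _ => by positivity,
      ENNReal.ofReal_sum_of_nonneg fun _ _ => by positivity] at h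
    have hhalf : ENNReal.ofReal 2⁻¹ = 2⁻¹ := by
      rw [ENNReal.ofReal_inv_of_pos (by norm_num)]; simp
    simpa only [ENNReal.ofReal_mul measureReal_nonneg,
      ENNReal.ofReal_mul (mul_nonneg measureReal_nonneg measureReal_nonneg),
      ENNReal.ofReal_mul (by norm_num : (0 : ℝ) ≤ 2⁻¹), hhalf,
      ofReal_measureReal (measure_ne_top _ _), mul_assoc] using h
  · refine tsum_congr fun ⟨n, hn⟩ => ?_
    simp only [Finset.coe_insert, Finset.coe_singleton, Set.mem_compl_iff, Set.mem_insert_iff,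
      Set.mem_singleton_iff, not_or] at hn
    have h1 : fairCoin {b | nextBit m n b = c} = 2⁻¹ := by
      rw [← ofReal_measureReal, fairCoin_real_nextBit, if_neg hn.2.1, if_neg hn.2.2,
        ENNReal.ofReal_inv_of_pos (by norm_num)]
      simp
    have h2 : addedLaw (poissonMeasure r) (ENNReal.ofReal (reduceProb m r)) m n c =
        poissonMeasure r := by
      cases c <;> simp [addedLaw, hn]
    simp only [h1, h2]
    ring

/-- The law of the auxiliary randomness of a cell used to choose the number of added points, as a
function of the number of points and of the bit. -/
noncomputable def addedNumberLaw (m : ℕ) (r : ℝ≥0) : Measure (ℕ × Bool → ℕ) :=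
  infinitePi fun p : ℕ × Bool =>
    addedLaw (poissonMeasure r) (ENNReal.ofReal (reduceProb m r)) m p.1 p.2

theorem isProbabilityMeasure_addedNumberLaw (m : ℕ) {r : ℝ≥0} (hr : 2 ≤ r) :
    IsProbabilityMeasure (addedNumberLaw m r) := by
  have hκ : ∀ p : ℕ × Bool, IsProbabilityMeasure
      (addedLaw (poissonMeasure r) (ENNReal.ofReal (reduceProb m r)) m p.1 p.2) := fun p =>
    isProbabilityMeasure_addedLaw _ (by simpa using reduceProb_le_one m hr) _ _ _
  unfold addedNumberLaw
  infer_instance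

theorem measurable_nextBit (m : ℕ) : Measurable fun p : ℕ × Bool => nextBit m p.1 p.2 :=
  Measurable.of_discrete

theorem measurable_eval_countable {γ Ω β : Type*} [MeasurableSpace γ] [MeasurableSpace Ω]
    [MeasurableSpace β] [Countable γ] [MeasurableSingletonClass γ] {g : Ω → γ} {w : Ω → γ → β}
    (hg : Measurable g) (hw : Measurable w) : Measurable fun ω => w ω (g ω) := by
  have h : Measurable fun p : γ × Ω => w p.2 p.1 :=
    measurable_from_prod_countable_right fun c => (measurable_pi_apply c).comp hw
  exact h.comp (hg.prodMk measurable_id)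

/-- Independence of the total number of points of a cell and the bit passed on to the preceding
cell, where the added number is read off from an independent function of the count and the bit. -/
theorem map_nextBit_add (m : ℕ) {r : ℝ≥0} (hr : 2 ≤ r) :
    (((poissonMeasure (m + 2)).prod fairCoin).prod (addedNumberLaw m r)).map
      (fun q => (nextBit m q.1.1 q.1.2, q.1.1 + q.2 (q.1.1, nextBit m q.1.1 q.1.2))) =
    fairCoin.prod (poissonMeasure (m + 2 + r)) := by
  have := isProbabilityMeasure_addedNumberLaw m hr
  have hκ : ∀ p : ℕ × Bool, IsProbabilityMeasure
      (addedLaw (poissonMeasure r) (ENNReal.ofReal (reduceProb m r)) m p.1 p.2) := fun p =>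
    isProbabilityMeasure_addedLaw _ (by simpa using reduceProb_le_one m hr) _ _ _
  have hb : Measurable fun q : (ℕ × Bool) × (ℕ × Bool → ℕ) => nextBit m q.1.1 q.1.2 :=
    (measurable_nextBit m).comp measurable_fst
  have hf : Measurable fun q : (ℕ × Bool) × (ℕ × Bool → ℕ) =>
      (nextBit m q.1.1 q.1.2, q.1.1 + q.2 (q.1.1, nextBit m q.1.1 q.1.2)) := by
    refine hb.prodMk (measurable_fst.fst.add (measurable_eval_countable
      (measurable_fst.fst.prodMk hb) measurable_snd))
  refine Measure.ext_of_singleton fun ⟨c, k⟩ => ?_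
  rw [map_apply hf (measurableSet_singleton _), prod_apply (hf (measurableSet_singleton _)),
    ← Set.singleton_prod_singleton, prod_prod, lintegral_prod _ Measurable.of_discrete.aemeasurable,
    lintegral_countable']
  have hc : fairCoin {c} = 2⁻¹ := by cases c <;> simp [fairCoin]
  rw [hc, ← tsum_addedLaw m hr c {k}]
  refine tsum_congr fun n => ?_
  rw [mul_comm]
  congr 1
  have hslice : ∀ b : Bool, addedNumberLaw m r (Prod.mk (n, b) ⁻¹'
      ((fun q : (ℕ × Bool) × (ℕ × Bool → ℕ) =>
        (nextBit m q.1.1 q.1.2, q.1.1 + q.2 (q.1.1, nextBit m q.1.1 q.1.2))) ⁻¹'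
          ({c} ×ˢ {k}))) = {b | nextBit m n b = c}.indicator (fun _ =>
        addedLaw (poissonMeasure r) (ENNReal.ofReal (reduceProb m r)) m n c
          ((n + ·) ⁻¹' {k})) b := by
    intro b
    by_cases h : nextBit m n b = c
    · rw [Set.indicator_of_mem (by exact h), ← infinitePi_map_eval (fun p : ℕ × Bool =>
        addedLaw (poissonMeasure r) (ENNReal.ofReal (reduceProb m r)) m p.1 p.2) (n, c),
        map_apply (measurable_pi_apply _) MeasurableSet.of_discrete]
      unfold addedNumberLaw
      congr 1
      ext w
      simp [h]
    · rw [Set.indicator_of_notMem (by exact h)]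
      convert measure_empty (μ := addedNumberLaw m r)
      ext w
      simp [h]
  simp only [hslice]
  rw [lintegral_indicator_const MeasurableSet.of_discrete, mul_comm]

end OneCell

/-! ### Thickening the data of one cell -/

section CellData

open Measure

theorem measurePreserving_prod_right_comm {α β γ : Type*} [MeasurableSpace α] [MeasurableSpace β]
    [MeasurableSpace γ] (μ : Measure α) (ν : Measure β) (ρ : Measure γ) [SFinite μ] [SFinite ν]
    [SFinite ρ] :
    MeasurePreserving (fun p : (α × β) × γ => ((p.1.1, p.2), p.1.2)) ((μ.prod ν).prod ρ)
      ((μ.prod ρ).prod ν) :=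
  (((measurePreserving_prodAssoc μ ρ ν).symm).comp
    ((MeasurePreserving.id μ).prod measurePreserving_swap)).comp (measurePreserving_prodAssoc μ ν ρ)

theorem measurePreserving_prod_prod_comm {α β γ δ : Type*} [MeasurableSpace α] [MeasurableSpace β]
    [MeasurableSpace γ] [MeasurableSpace δ] (μ : Measure α) (ν : Measure β) (ρ : Measure γ)
    (σ : Measure δ) [SFinite μ] [SFinite ν] [SFinite ρ] [SFinite σ] :
    MeasurePreserving (fun p : (α × β) × (γ × δ) => ((p.1.1, p.2.1), (p.1.2, p.2.2)))
      ((μ.prod ν).prod (ρ.prod σ)) ((μ.prod ρ).prod (ν.prod σ)) :=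
  (((MeasurePreserving.id (μ.prod ρ)).prod measurePreserving_swap).comp
    (measurePreserving_prodAssoc (μ.prod ρ) σ ν)).comp
      ((((measurePreserving_prodAssoc μ ρ σ).symm).prod (MeasurePreserving.id ν)).comp
        (measurePreserving_prod_right_comm μ ν (ρ.prod σ)))

/-- The law of a sequence of independent uniform positions in a cell. -/
noncomputable def posLaw : Measure (ℕ → ℝ) := infinitePi fun _ => unif

instance : IsProbabilityMeasure posLaw := by unfold posLaw; infer_instance

/-- The law of the data of one cell: the Poisson number `n` of its points, and a sequence of
independent uniform positions, of which the first `n` are occupied. -/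
noncomputable def cellLaw (a : ℝ≥0) : Measure (ℕ × (ℕ → ℝ)) := (poissonMeasure a).prod posLaw

instance (a : ℝ≥0) : IsProbabilityMeasure (cellLaw a) := by unfold cellLaw; infer_instance

/-- The sequence that follows `u` before the index `n` and `v` from `n` on. -/
def splice (n : ℕ) (u v : ℕ → ℝ) : ℕ → ℝ := fun i => if i < n then u i else v i

theorem map_splice (n : ℕ) : (posLaw.prod posLaw).map (fun p => splice n p.1 p.2) = posLaw := by
  have hm : ∀ i, Measurable fun q : ℝ × ℝ => if i < n then q.1 else q.2 := fun i => by
    split_ifs <;> fun_prop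
  have hs : Measurable fun p : (ℕ → ℝ) × (ℕ → ℝ) => splice n p.1 p.2 :=
    measurable_pi_lambda _ fun i => by
      unfold splice
      split_ifs <;> fun_prop
  have h := infinitePi_map_pi (fun _ : ℕ => unif.prod unif) hm
  unfold posLaw
  rw [← infinitePi_prod_map_unzip, map_map hs (by fun_prop)]
  refine Eq.trans ?_ (h.trans ?_)
  · rfl
  · congr 1
    funext i
    split_ifs
    exacts [map_fst_prod.trans (by simp), map_snd_prod.trans (by simp)]

theorem measurable_splice :
    Measurable fun p : ℕ × ((ℕ → ℝ) × (ℕ → ℝ)) => splice p.1 p.2.1 p.2.2 := by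
  refine measurable_from_prod_countable_right fun n => measurable_pi_lambda _ fun i => ?_
  change Measurable fun p : (ℕ → ℝ) × (ℕ → ℝ) => if i < n then p.1 i else p.2 i
  split_ifs <;> fun_prop

/-- The auxiliary randomness of a cell: the numbers of added points and their positions. -/
abbrev Aux : Type := (ℕ × Bool → ℕ) × (ℕ → ℝ)

/-- The law of the auxiliary randomness of a cell. -/
noncomputable def auxLaw (m : ℕ) (r : ℝ≥0) : Measure Aux := (addedNumberLaw m r).prod posLaw

theorem isProbabilityMeasure_auxLaw (m : ℕ) {r : ℝ≥0} (hr : 2 ≤ r) :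
    IsProbabilityMeasure (auxLaw m r) := by
  have := isProbabilityMeasure_addedNumberLaw m hr
  unfold auxLaw
  infer_instance

/-- The data of the thickened cell, given the data of the cell, its auxiliary randomness and the
bit `b` of the following cells. -/
def thickenCell (m : ℕ) (ζ : (ℕ × (ℕ → ℝ)) × Aux) (b : Bool) : ℕ × (ℕ → ℝ) :=
  (ζ.1.1 + ζ.2.1 (ζ.1.1, nextBit m ζ.1.1 b), splice ζ.1.1 ζ.1.2 ζ.2.2)

theorem measurable_thickenCell (m : ℕ) :
    Measurable fun p : ((ℕ × (ℕ → ℝ)) × Aux) × Bool => thickenCell m p.1 p.2 := by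
  have hb : Measurable fun p : ((ℕ × (ℕ → ℝ)) × Aux) × Bool => nextBit m p.1.1.1 p.2 :=
    (measurable_nextBit m).comp (measurable_fst.fst.fst.prodMk measurable_snd)
  refine Measurable.prodMk ?_ ?_
  · exact measurable_fst.fst.fst.add (measurable_eval_countable
      (measurable_fst.fst.fst.prodMk hb) measurable_fst.snd.fst)
  · exact measurable_splice.comp (f := fun p : ((ℕ × (ℕ → ℝ)) × Aux) × Bool =>
      (p.1.1.1, (p.1.1.2, p.1.2.2))) (by fun_prop)

/-- One step of the chain: the thickened cell has the right law and is independent of the bit passed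
on to the preceding cell. -/
theorem map_thickenCell (m : ℕ) {r : ℝ≥0} (hr : 2 ≤ r) :
    (((cellLaw (m + 2)).prod (auxLaw m r)).prod fairCoin).map
      (fun p => (nextBit m p.1.1.1 p.2, thickenCell m p.1 p.2)) =
    fairCoin.prod (cellLaw (m + 2 + r)) := by
  have := isProbabilityMeasure_addedNumberLaw m hr
  -- bring the discrete coordinates to the front
  have h1 := (measurePreserving_prod_prod_comm (poissonMeasure (m + 2)) posLaw
    (addedNumberLaw m r) posLaw).prod (MeasurePreserving.id fairCoin)
  have h2 := measurePreserving_prod_right_comm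
    ((poissonMeasure (m + 2)).prod (addedNumberLaw m r)) (posLaw.prod posLaw) fairCoin
  have h3 := (measurePreserving_prod_right_comm (poissonMeasure (m + 2)) (addedNumberLaw m r)
    fairCoin).prod (MeasurePreserving.id (posLaw.prod posLaw))
  have hb : Measurable fun q : (ℕ × Bool) × (ℕ × Bool → ℕ) => nextBit m q.1.1 q.1.2 :=
    (measurable_nextBit m).comp measurable_fst
  have hcount : MeasurePreserving (fun q : (ℕ × Bool) × (ℕ × Bool → ℕ) =>
      (nextBit m q.1.1 q.1.2, q.1.1 + q.2 (q.1.1, nextBit m q.1.1 q.1.2)))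
      (((poissonMeasure (m + 2)).prod fairCoin).prod (addedNumberLaw m r))
      (fairCoin.prod (poissonMeasure (m + 2 + r))) :=
    ⟨hb.prodMk (measurable_fst.fst.add (measurable_eval_countable
      (measurable_fst.fst.prodMk hb) measurable_snd)), map_nextBit_add m hr⟩
  have h4 := hcount.skew_product (μc := posLaw.prod posLaw) (μd := posLaw)
    (g := fun q p => splice q.1.1 p.1 p.2)
    (measurable_splice.comp (f := fun z : ((ℕ × Bool) × (ℕ × Bool → ℕ)) × ((ℕ → ℝ) × (ℕ → ℝ)) =>
      (z.1.1.1, z.2)) (by fun_prop)) (ae_of_all _ fun q => map_splice q.1.1)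
  have h5 := measurePreserving_prodAssoc fairCoin (poissonMeasure (m + 2 + r)) posLaw
  exact ((((h5.comp h4).comp h3).comp h2).comp h1).map_eq

end CellData

/-! ### The chain of cells and the chain of blocks -/

section Chains

open Measure

/-- One step of a chain, performed independently in every coordinate. -/
theorem step_infinitePi {ι A S Z : Type*} [MeasurableSpace A] [MeasurableSpace S]
    [MeasurableSpace Z] {m : Measure A} [IsProbabilityMeasure m] {π : Measure S}
    [IsProbabilityMeasure π] {ν : Measure Z} [IsProbabilityMeasure ν] {T : A → S → S}
    {Φ : A → S → Z} (hT : Measurable fun p : A × S => T p.1 p.2)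
    (hΦ : Measurable fun p : A × S => Φ p.1 p.2)
    (hstep : (m.prod π).map (fun p => (T p.1 p.2, Φ p.1 p.2)) = π.prod ν) :
    ((infinitePi fun _ : ι => m).prod (infinitePi fun _ : ι => π)).map
      (fun p => (fun i => T (p.1 i) (p.2 i), fun i => Φ (p.1 i) (p.2 i))) =
    (infinitePi fun _ : ι => π).prod (infinitePi fun _ : ι => ν) := by
  have h : Measurable fun p : A × S => (T p.1 p.2, Φ p.1 p.2) := hT.prodMk hΦ
  rw [← infinitePi_prod_map_unzip π ν, ← hstep,
    ← infinitePi_map_pi (fun _ : ι => m.prod π) fun _ => h, ← infinitePi_prod_map_zip,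
    map_map (by fun_prop) (by fun_prop), map_map (by fun_prop) (by fun_prop)]
  rfl

/-- The sequence of bits encoded in a block with count `x n i` in row `i` and column `n`: every row
encodes one bit. -/
noncomputable def rowBits (m : ℕ) (x : ℕ → ℕ → ℕ) : ℕ → Bool := fun i => firstBit m fun n => x n i

theorem measurable_rowBits (m : ℕ) : Measurable (rowBits m) :=
  measurable_pi_lambda _ fun _ => (measurable_firstBit m).comp (by fun_prop)

theorem measurable_rowBits_comp (m : ℕ) {X : Type*} [MeasurableSpace X] {c : X → ℕ → ℕ → ℕ}
    (hc : Measurable c) : Measurable fun x => rowBits m (c x) :=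
  (measurable_rowBits m).comp hc

theorem poissonMeasure_real_encoding (m : ℕ) :
    (poissonMeasure (m + 2)).real {m + 1} = (poissonMeasure (m + 2)).real {m + 2} ∧
      (poissonMeasure (m + 2)).real {m + 2} ≠ 0 :=
  ⟨(poissonMeasure_real_succ m).2.symm, (poissonMeasure_real_singleton_pos _ (by positivity)).ne'⟩

/-- The bits encoded in the rows of a block are independent and fair. -/
theorem map_rowBits (m : ℕ) :
    (infinitePi fun _ : ℕ => infinitePi fun _ : ℕ => poissonMeasure (m + 2)).map (rowBits m) =
      infinitePi fun _ : ℕ => fairCoin := by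
  have h := infinitePi_map_pi (fun _ : ℕ => infinitePi fun _ : ℕ => poissonMeasure (m + 2))
    fun _ => measurable_firstBit m
  have hg : Measurable fun (x : ℕ → ℕ → ℕ) i => firstBit m (x i) :=
    measurable_pi_lambda _ fun i => (measurable_firstBit m).comp (measurable_pi_apply i)
  rw [map_firstBit (poissonMeasure_real_encoding m).1 (poissonMeasure_real_encoding m).2,
    ← infinitePi_map_swap, map_map hg (by fun_prop)] at h
  exact h

theorem map_rowBits_comp (m : ℕ) {X : Type*} [MeasurableSpace X] {μ : Measure X}
    [IsProbabilityMeasure μ] {c : X → ℕ} (hc : Measurable c)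
    (h : μ.map c = poissonMeasure (m + 2)) :
    (infinitePi fun _ : ℕ => infinitePi fun _ : ℕ => μ).map
      (fun ζ => rowBits m fun n i => c (ζ n i)) = infinitePi fun _ : ℕ => fairCoin := by
  have h1 := infinitePi_map_pi (fun _ : ℕ => μ) fun _ => hc
  have h2 := infinitePi_map_pi (fun _ : ℕ => infinitePi fun _ : ℕ => μ)
    (f := fun _ x i => c (x i)) fun _ => by fun_prop
  rw [h1, h] at h2
  rw [← map_rowBits, ← h2, map_map (measurable_rowBits m) (by fun_prop)]
  rfl

theorem cellLaw_map_fst (a : ℝ≥0) : (cellLaw a).map Prod.fst = poissonMeasure a := by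
  rw [cellLaw, map_fst_prod]; simp

/-- Thickening one block with auxiliary randomness: the block that comes out has the right law and
is independent of the bits encoded in the block. -/
theorem map_thickenBlock (m : ℕ) {r : ℝ≥0} (hr : 2 ≤ r) :
    haveI := isProbabilityMeasure_auxLaw m hr
    (infinitePi fun _ : ℕ => infinitePi fun _ : ℕ => (cellLaw (m + 2)).prod (auxLaw m r)).map
      (fun ζ => (rowBits m fun n i => (ζ n i).1.1,
        fun n i => thickenCell m (ζ n i) (rowBits m (fun k i => (ζ (n + 1 + k) i).1.1) i))) =
    (infinitePi fun _ : ℕ => fairCoin).prod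
      (infinitePi fun _ : ℕ => infinitePi fun _ : ℕ => cellLaw (m + 2 + r)) := by
  have := isProbabilityMeasure_auxLaw m hr
  have hT : Measurable fun p : ((ℕ × (ℕ → ℝ)) × Aux) × Bool => nextBit m p.1.1.1 p.2 :=
    (measurable_nextBit m).comp (measurable_fst.fst.fst.prodMk measurable_snd)
  have hΦ := measurable_thickenCell m
  refine chain_map_eq
    (T := fun (ζ : ℕ → (ℕ × (ℕ → ℝ)) × Aux) (b : ℕ → Bool) i => nextBit m (ζ i).1.1 (b i))
    (Φ := fun ζ b i => thickenCell m (ζ i) (b i))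
    (y := fun ζ => rowBits m fun n i => (ζ n i).1.1) ?_ ?_
    (step_infinitePi (T := fun ζ b => nextBit m ζ.1.1 b) hT hΦ (map_thickenCell m hr)) ?_ ?_ ?_
  · exact measurable_pi_lambda _ fun i => hT.comp
      (f := fun p : (ℕ → (ℕ × (ℕ → ℝ)) × Aux) × (ℕ → Bool) => (p.1 i, p.2 i)) (by fun_prop)
  · exact measurable_pi_lambda _ fun i => hΦ.comp
      (f := fun p : (ℕ → (ℕ × (ℕ → ℝ)) × Aux) × (ℕ → Bool) => (p.1 i, p.2 i)) (by fun_prop)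
  · exact measurable_rowBits_comp m
      (c := fun (ζ : ℕ → ℕ → (ℕ × (ℕ → ℝ)) × Aux) n i => (ζ n i).1.1) (by fun_prop)
  · intro ζ
    funext i
    exact firstBit_eq m _
  · refine map_rowBits_comp m (c := fun x : (ℕ × (ℕ → ℝ)) × Aux => x.1.1) (by fun_prop) ?_
    have : (fun x : (ℕ × (ℕ → ℝ)) × Aux => x.1.1) = Prod.fst ∘ Prod.fst := rfl
    rw [this, ← map_map measurable_fst measurable_fst, map_fst_prod]
    simp [cellLaw_map_fst]

/-- Thickening all blocks, where the auxiliary randomness of a block is the image under `V` of the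
bits encoded in the next block. -/
theorem map_thickenBlocks (m : ℕ) {r : ℝ≥0} (hr : 2 ≤ r) {V : (ℕ → Bool) → ℕ → ℕ → Aux}
    (hV : Measurable V)
    (hVlaw : (infinitePi fun _ : ℕ => fairCoin).map V =
      infinitePi fun _ : ℕ => infinitePi fun _ : ℕ => auxLaw m r) :
    (infinitePi fun _ : ℕ => infinitePi fun _ : ℕ => infinitePi fun _ : ℕ => cellLaw (m + 2)).map
      (fun ξ k n i => thickenCell m (ξ k n i, V (rowBits m fun n i => (ξ (k + 1) n i).1) n i)
        (rowBits m (fun j i => (ξ k (n + 1 + j) i).1) i)) =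
    infinitePi fun _ : ℕ => infinitePi fun _ : ℕ => infinitePi fun _ : ℕ =>
      cellLaw (m + 2 + r) := by
  have := isProbabilityMeasure_auxLaw m hr
  set M := infinitePi fun _ : ℕ => infinitePi fun _ : ℕ => cellLaw (m + 2) with hM
  -- combining a block with the randomness extracted from independent bits
  let zip : ((ℕ → ℕ → ℕ × (ℕ → ℝ)) × (ℕ → Bool)) → ℕ → ℕ → (ℕ × (ℕ → ℝ)) × Aux :=
    fun p n i => (p.1 n i, V p.2 n i)
  have hzip : Measurable zip := by
    refine measurable_pi_lambda _ fun n => measurable_pi_lambda _ fun i => ?_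
    refine Measurable.prodMk (by fun_prop) ?_
    exact (measurable_pi_apply i).comp ((measurable_pi_apply n).comp (hV.comp measurable_snd))
  have hziplaw : (M.prod (infinitePi fun _ : ℕ => fairCoin)).map zip =
      infinitePi fun _ : ℕ => infinitePi fun _ : ℕ => (cellLaw (m + 2)).prod (auxLaw m r) := by
    have e1 : (M.prod (infinitePi fun _ : ℕ => fairCoin)).map (Prod.map id V) =
        M.prod (infinitePi fun _ : ℕ => infinitePi fun _ : ℕ => auxLaw m r) := by
      rw [← hVlaw, ← map_prod_map _ _ measurable_id hV, map_id]
    have e2 := infinitePi_map_pi (fun _ : ℕ => (infinitePi fun _ : ℕ => cellLaw (m + 2)).prod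
      (infinitePi fun _ : ℕ => auxLaw m r)) (f := fun _ p i => (p.1 i, p.2 i))
      fun _ => by fun_prop
    rw [infinitePi_prod_map_zip, ← infinitePi_prod_map_zip, ← hM, ← e1,
      map_map (by fun_prop) (measurable_id.prodMap hV), map_map (by fun_prop)
        ((by fun_prop : Measurable _).comp (measurable_id.prodMap hV))] at e2
    exact e2
  have hblock := map_thickenBlock m hr
  have hout : Measurable fun ζ : ℕ → ℕ → (ℕ × (ℕ → ℝ)) × Aux => fun n i =>
      thickenCell m (ζ n i) (rowBits m (fun k i => (ζ (n + 1 + k) i).1.1) i) := by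
    refine measurable_pi_lambda _ fun n => measurable_pi_lambda _ fun i => ?_
    refine (measurable_thickenCell m).comp (f := fun ζ : ℕ → ℕ → (ℕ × (ℕ → ℝ)) × Aux =>
      (ζ n i, rowBits m (fun k i => (ζ (n + 1 + k) i).1.1) i)) ?_
    refine Measurable.prodMk (by fun_prop) ((measurable_pi_apply i).comp
      (measurable_rowBits_comp m (c := fun (ζ : ℕ → ℕ → (ℕ × (ℕ → ℝ)) × Aux) k i =>
        (ζ (n + 1 + k) i).1.1) (by fun_prop)))
  have hbits : Measurable fun ξ : ℕ → ℕ → ℕ × (ℕ → ℝ) => rowBits m fun n i => (ξ n i).1 :=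
    measurable_rowBits_comp m (by fun_prop)
  have hstep : (M.prod (infinitePi fun _ : ℕ => fairCoin)).map
      (fun p => (rowBits m fun n i => (p.1 n i).1, fun n i =>
        thickenCell m (zip p n i) (rowBits m (fun k i => (zip p (n + 1 + k) i).1.1) i))) =
      (infinitePi fun _ : ℕ => fairCoin).prod
        (infinitePi fun _ : ℕ => infinitePi fun _ : ℕ => cellLaw (m + 2 + r)) := by
    rw [← hblock, ← hziplaw, map_map (Measurable.prodMk
      (measurable_rowBits_comp m (by fun_prop)) hout) hzip]
    rfl
  have hchain := chain_map_eq (T := fun ξ _ => rowBits m fun n i => (ξ n i).1)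
    (Φ := fun ξ b n i => thickenCell m (zip (ξ, b) n i)
      (rowBits m (fun k i => (zip (ξ, b) (n + 1 + k) i).1.1) i))
    (y := fun ξ : ℕ → ℕ → ℕ → ℕ × (ℕ → ℝ) => rowBits m fun n i => (ξ 0 n i).1)
    (hbits.comp measurable_fst) (hout.comp hzip) hstep (hbits.comp (by fun_prop)) (fun _ => rfl) (by
      have : (fun ξ : ℕ → ℕ → ℕ → ℕ × (ℕ → ℝ) => rowBits m fun n i => (ξ 0 n i).1) =
        (fun ξ : ℕ → ℕ → ℕ × (ℕ → ℝ) => rowBits m fun n i => (ξ n i).1) ∘ fun ξ => ξ 0 := rfl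
      rw [this, ← map_map hbits (measurable_pi_apply 0), infinitePi_map_eval]
      exact map_rowBits_comp m measurable_fst (cellLaw_map_fst _))
  have hsnd := congrArg (fun μ => μ.map Prod.snd) hchain
  simp only [map_snd_prod, measure_univ, one_smul] at hsnd
  rw [map_map measurable_snd] at hsnd
  · exact hsnd
  · refine Measurable.prodMk (hbits.comp (by fun_prop)) (measurable_pi_lambda _ fun k => ?_)
    exact (hout.comp hzip).comp (f := fun ξ : ℕ → ℕ → ℕ → ℕ × (ℕ → ℝ) =>
      (ξ k, rowBits m fun n i => (ξ (k + 1 + 0) n i).1))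
      (Measurable.prodMk (by fun_prop) (hbits.comp (by fun_prop)))

theorem infinitePi_map_reindex {ι α : Type*} [MeasurableSpace α] (μ : Measure α)
    [IsProbabilityMeasure μ] (e : ι ≃ ℕ × ℕ × ℕ) :
    (infinitePi fun _ : ι => μ).map (fun f k n i => f (e.symm (k, n, i))) =
      infinitePi fun _ : ℕ => infinitePi fun _ : ℕ => infinitePi fun _ : ℕ => μ := by
  have h1 := map_infinitePi_infinitePi_of_inj (P := fun _ : ι => μ) e.symm.injective
  have h2 := infinitePi_map_curry fun (_ : ℕ) (_ : ℕ × ℕ) => μ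
  have h3 := infinitePi_map_pi (fun _ : ℕ => infinitePi fun _ : ℕ × ℕ => μ)
    (f := fun _ => MeasurableEquiv.curry ℕ ℕ α) fun _ => MeasurableEquiv.measurable _
  rw [infinitePi_map_curry fun (_ : ℕ) (_ : ℕ) => μ, ← h2, ← h1,
    map_map (MeasurableEquiv.measurable _) (by fun_prop), map_map (by fun_prop)
      ((MeasurableEquiv.measurable _).comp (by fun_prop))] at h3
  exact h3

/-- The thickening on the level of cells: there are numbers `R` of added points and positions `P`,
depending only on the numbers of points in the cells, which turn the data of independent cells with
mean `m + 2` into the data of independent cells with mean `m + 2 + r`. -/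
theorem exists_thickenCells (m : ℕ) {r : ℝ≥0} (hr : 2 ≤ r) :
    ∃ (R : (ℤ → ℕ) → ℤ → ℕ) (P : (ℤ → ℕ) → ℤ → ℕ → ℝ), Measurable R ∧ Measurable P ∧
      (infinitePi fun _ : ℤ => cellLaw (m + 2)).map (fun ξ z =>
        ((ξ z).1 + R (fun z => (ξ z).1) z,
          splice (ξ z).1 (ξ z).2 (P (fun z => (ξ z).1) z))) =
      infinitePi fun _ : ℤ => cellLaw (m + 2 + r) := by
  have := isProbabilityMeasure_auxLaw m hr
  have hsb : StandardBorelSpace (ℕ → Aux) := inferInstance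
  have hsb' : StandardBorelSpace (ℕ → ℕ → Aux) := StandardBorelSpace.pi_countable
  obtain ⟨V, hV, hVlaw⟩ := exists_measurable_map_fairCoin_eq
    (infinitePi fun _ : ℕ => infinitePi fun _ : ℕ => auxLaw m r)
  -- the block, the column and the row of a cell
  have e : ℤ ≃ ℕ × ℕ × ℕ := Denumerable.equiv₂ ℤ (ℕ × ℕ × ℕ)
  let aux : (ℤ → ℕ) → ℤ → Aux := fun N z =>
    V (rowBits m fun n i => N (e.symm ((e z).1 + 1, n, i))) (e z).2.1 (e z).2.2
  let bit : (ℤ → ℕ) → ℤ → Bool := fun N z =>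
    rowBits m (fun j i => N (e.symm ((e z).1, (e z).2.1 + 1 + j, i))) (e z).2.2
  have haux : Measurable aux := measurable_pi_lambda _ fun z =>
    (measurable_pi_apply _).comp ((measurable_pi_apply _).comp
      (hV.comp (measurable_rowBits_comp m (by fun_prop))))
  have hbit : Measurable bit := measurable_pi_lambda _ fun z =>
    (measurable_pi_apply _).comp (measurable_rowBits_comp m
      (c := fun (N : ℤ → ℕ) j i => N (e.symm ((e z).1, (e z).2.1 + 1 + j, i))) (by fun_prop))
  have hpick : ∀ z, Measurable fun N : ℤ → ℕ => (N z, nextBit m (N z) (bit N z)) := fun z =>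
    (measurable_pi_apply z).prodMk ((measurable_nextBit m).comp
      ((measurable_pi_apply z).prodMk ((measurable_pi_apply z).comp hbit)))
  refine ⟨fun N z => (aux N z).1 (N z, nextBit m (N z) (bit N z)), fun N z => (aux N z).2,
    measurable_pi_lambda _ fun z => measurable_eval_countable (hpick z)
      ((measurable_pi_apply z).comp haux).fst,
    measurable_pi_lambda _ fun z => ((measurable_pi_apply z).comp haux).snd, ?_⟩
  have h := map_thickenBlocks m hr hV hVlaw
  rw [← infinitePi_map_reindex _ e, ← infinitePi_map_reindex _ e] at h
  have hback : ∀ μ : Measure (ℤ → ℕ × (ℕ → ℝ)),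
      (μ.map fun f k n i => f (e.symm (k, n, i))).map (fun g z => g (e z).1 (e z).2.1 (e z).2.2) =
        μ := by
    intro μ
    rw [map_map (by fun_prop) (by fun_prop)]
    convert Measure.map_id
    funext f z
    simp
  have hm : Measurable fun (ξ : ℕ → ℕ → ℕ → ℕ × (ℕ → ℝ)) k n i =>
      thickenCell m (ξ k n i, V (rowBits m fun n i => (ξ (k + 1) n i).1) n i)
        (rowBits m (fun j i => (ξ k (n + 1 + j) i).1) i) := by
    refine measurable_pi_lambda _ fun k => measurable_pi_lambda _ fun n =>
      measurable_pi_lambda _ fun i => ?_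
    have h1 : Measurable fun ξ : ℕ → ℕ → ℕ → ℕ × (ℕ → ℝ) =>
        V (rowBits m fun n i => (ξ (k + 1) n i).1) := hV.comp (measurable_rowBits_comp m
      (c := fun (ξ : ℕ → ℕ → ℕ → ℕ × (ℕ → ℝ)) n i => (ξ (k + 1) n i).1) (by fun_prop))
    have h2 := measurable_rowBits_comp m
      (c := fun (ξ : ℕ → ℕ → ℕ → ℕ × (ℕ → ℝ)) j i => (ξ k (n + 1 + j) i).1) (by fun_prop)
    exact (measurable_thickenCell m).comp (Measurable.prodMk (Measurable.prodMk (by fun_prop)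
      ((measurable_pi_apply i).comp ((measurable_pi_apply n).comp h1)))
      ((measurable_pi_apply i).comp h2))
  have hfrom : Measurable fun (g : ℕ → ℕ → ℕ → ℕ × (ℕ → ℝ)) (z : ℤ) =>
      g (e z).1 (e z).2.1 (e z).2.2 := by fun_prop
  rw [← hback (infinitePi fun _ : ℤ => cellLaw (m + 2 + r)), ← h, map_map hm (by fun_prop),
    map_map hfrom (hm.comp (by fun_prop))]
  congr 1
  funext ξ z
  simp [thickenCell, aux, bit]

end Chains

/-! ### Configurations of points from cell data -/

section Config

open Measure

/-- The cell `[z L, (z + 1) L)`. -/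
def cell (L : ℝ) (z : ℤ) : Set ℝ := Set.Ico (z * L) ((z + 1) * L)

theorem measurableSet_cell (L : ℝ) (z : ℤ) : MeasurableSet (cell L z) := measurableSet_Ico

theorem mem_cell_iff {L : ℝ} (hL : 0 < L) {z : ℤ} {x : ℝ} : x ∈ cell L z ↔ ⌊x / L⌋ = z := by
  rw [Int.floor_eq_iff, le_div_iff₀ hL, div_lt_iff₀ hL, cell, Set.mem_Ico]

/-- The point of the cell `z` with relative position `t`; only the fractional part of `t` matters,
so that the point always lies in the cell. -/
noncomputable def cellPoint (L : ℝ) (z : ℤ) (t : ℝ) : ℝ := z * L + L * Int.fract t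

theorem cellPoint_mem_cell {L : ℝ} (hL : 0 < L) (z : ℤ) (t : ℝ) : cellPoint L z t ∈ cell L z := by
  have h0 := Int.fract_nonneg t
  have h1 := Int.fract_lt_one t
  constructor <;> unfold cellPoint <;> nlinarith

theorem measurable_cellPoint (L : ℝ) (z : ℤ) : Measurable (cellPoint L z) := by
  unfold cellPoint; fun_prop

theorem cellPoint_inj {L : ℝ} (hL : 0 < L) {z w : ℤ} {s t : ℝ}
    (h : cellPoint L z s = cellPoint L w t) : z = w ∧ Int.fract s = Int.fract t := by
  have hz : z = w := by
    rw [← (mem_cell_iff hL).1 (cellPoint_mem_cell hL z s), h,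
      (mem_cell_iff hL).1 (cellPoint_mem_cell hL w t)]
  subst hz
  refine ⟨rfl, ?_⟩
  have : L * Int.fract s = L * Int.fract t := by unfold cellPoint at h; linarith
  exact mul_left_cancel₀ hL.ne' this

/-- The configuration with the points `u z i`, `lo z ≤ i < hi z`, in each cell `z`. -/
noncomputable def config {L : ℝ} (hL : 0 < L) (lo hi : ℤ → ℕ) (u : ℤ → ℕ → ℝ) : LocFinSet where
  carrier := {x | ∃ z i, lo z ≤ i ∧ i < hi z ∧ cellPoint L z (u z i) = x}
  finite_inter K hK := by
    obtain ⟨a, ha⟩ := hK.bddBelow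
    obtain ⟨b, hb⟩ := hK.bddAbove
    have hfin : (⋃ z ∈ Set.Icc ⌊a / L⌋ ⌊b / L⌋,
        (fun i => cellPoint L z (u z i)) '' Set.Iio (hi z)).Finite :=
      (Set.finite_Icc _ _).biUnion fun z _ => (Set.finite_Iio _).image _
    refine hfin.subset ?_
    rintro _ ⟨⟨z, i, -, hi, rfl⟩, hx⟩
    have hz := (mem_cell_iff hL).1 (cellPoint_mem_cell hL z (u z i))
    refine Set.mem_biUnion (x := z) ?_ ⟨i, hi, rfl⟩
    rw [← hz]
    exact ⟨Int.floor_le_floor (by gcongr; exact ha hx), Int.floor_le_floor (by gcongr; exact hb hx)⟩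

theorem LocFinSet.measurable_iff {Ω : Type*} [MeasurableSpace Ω] {f : Ω → LocFinSet} :
    Measurable f ↔ ∀ B : Set ℝ, MeasurableSet B → Measurable fun ω => LocFinSet.count B (f ω) := by
  refine ⟨fun h B hB => (LocFinSet.measurable_count hB).comp h, fun h => ?_⟩
  refine measurable_iff_comap_le.2 ?_
  change MeasurableSpace.comap f (⨆ B : {B : Set ℝ // MeasurableSet B},
    MeasurableSpace.comap (LocFinSet.count B.1) ⊤) ≤ _
  rw [MeasurableSpace.comap_iSup]
  refine iSup_le fun B => ?_
  rw [MeasurableSpace.comap_comp]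
  exact measurable_iff_comap_le.1 (h B.1 B.2)

/-- Points are counted by the index of their first occurrence. -/
theorem count_config {L : ℝ} (hL : 0 < L) (lo hi : ℤ → ℕ) (u : ℤ → ℕ → ℝ) (B : Set ℝ) :
    LocFinSet.count B (config hL lo hi u) =
      {p : ℤ × ℕ | lo p.1 ≤ p.2 ∧ p.2 < hi p.1 ∧ cellPoint L p.1 (u p.1 p.2) ∈ B ∧
        ∀ j, lo p.1 ≤ j → j < p.2 → Int.fract (u p.1 j) ≠ Int.fract (u p.1 p.2)}.encard := by
  classical
  rw [LocFinSet.count, ← Set.InjOn.encard_image (f := fun p : ℤ × ℕ => cellPoint L p.1 (u p.1 p.2))]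
  · congr 1
    ext x
    constructor
    · rintro ⟨⟨z, i, h1, h2, rfl⟩, hB⟩
      have hex : ∃ j, lo z ≤ j ∧ Int.fract (u z j) = Int.fract (u z i) := ⟨i, h1, rfl⟩
      have hle : Nat.find hex ≤ i := Nat.find_min' hex ⟨h1, rfl⟩
      have heq : cellPoint L z (u z (Nat.find hex)) = cellPoint L z (u z i) := by
        unfold cellPoint; rw [(Nat.find_spec hex).2]
      refine ⟨(z, Nat.find hex), ⟨(Nat.find_spec hex).1, hle.trans_lt h2, ?_, ?_⟩, heq⟩
      · simpa only [heq] using hB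
      · intro j hj hjlt hfr
        exact Nat.find_min hex hjlt ⟨hj, hfr.trans (Nat.find_spec hex).2⟩
    · rintro ⟨⟨z, i⟩, ⟨h1, h2, h3, -⟩, rfl⟩
      exact ⟨⟨z, i, h1, h2, rfl⟩, h3⟩
  · rintro ⟨z, i⟩ ⟨h1, -, -, h2⟩ ⟨w, j⟩ ⟨h3, -, -, h4⟩ h
    obtain ⟨rfl, hf⟩ := cellPoint_inj hL h
    rcases lt_trichotomy i j with hij | rfl | hij
    · exact absurd hf (h4 i h1 hij)
    · rfl
    · exact absurd hf.symm (h2 j h3 hij)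

theorem measurable_config {L : ℝ} (hL : 0 < L) {Ω : Type*} [MeasurableSpace Ω] {lo hi : Ω → ℤ → ℕ}
    {u : Ω → ℤ → ℕ → ℝ} (hlo : Measurable lo) (hhi : Measurable hi) (hu : Measurable u) :
    Measurable fun ω => config hL (lo ω) (hi ω) (u ω) := by
  refine LocFinSet.measurable_iff.2 fun B hB => ?_
  simp only [count_config]
  refine measurable_encard.comp (measurable_set_iff.2 fun p => ?_)
  have hui : ∀ i, Measurable fun ω => u ω p.1 i := fun i =>
    (measurable_pi_apply i).comp ((measurable_pi_apply p.1).comp hu)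
  have hl : Measurable fun ω => lo ω p.1 := (measurable_pi_apply p.1).comp hlo
  have hh : Measurable fun ω => hi ω p.1 := (measurable_pi_apply p.1).comp hhi
  refine Measurable.and ?_ (Measurable.and ?_ (Measurable.and ?_ ?_))
  · exact (measurableSet_le hl measurable_const).mem
  · exact (measurableSet_lt measurable_const hh).mem
  · exact ((measurable_cellPoint L p.1).comp (hui _) hB).mem
  · refine Measurable.forall fun j => Measurable.imp ?_ (Measurable.imp measurable_const ?_)
    · exact (measurableSet_le hl measurable_const).mem
    · exact (measurableSet_eq_fun (measurable_fract.comp (hui _))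
        (measurable_fract.comp (hui _))).compl.mem

/-- Cell data in which all positions are admissible and distinct within each cell; almost all cell
data have this property. -/
def Admissible (ξ : ℤ → ℕ × (ℕ → ℝ)) : Prop :=
  ∀ z i, (ξ z).2 i ∈ Set.Ico (0 : ℝ) 1 ∧ ∀ j, j ≠ i → (ξ z).2 j ≠ (ξ z).2 i

/-- The configuration described by cell data. -/
noncomputable def cellConfig {L : ℝ} (hL : 0 < L) (ξ : ℤ → ℕ × (ℕ → ℝ)) : LocFinSet :=
  config hL (fun _ => 0) (fun z => (ξ z).1) (fun z => (ξ z).2)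

theorem measurable_cellConfig {L : ℝ} (hL : 0 < L) : Measurable (cellConfig hL) :=
  measurable_config hL (by fun_prop) (by fun_prop) (by fun_prop)

theorem count_cellConfig {L : ℝ} (hL : 0 < L) {ξ : ℤ → ℕ × (ℕ → ℝ)} (hξ : Admissible ξ)
    (B : Set ℝ) : LocFinSet.count B (cellConfig hL ξ) =
      {p : ℤ × ℕ | p.2 < (ξ p.1).1 ∧ cellPoint L p.1 ((ξ p.1).2 p.2) ∈ B}.encard := by
  rw [cellConfig, count_config]
  congr 1
  ext ⟨z, i⟩
  simp only [Set.mem_ofPred_eq, Nat.zero_le, true_and, true_implies]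
  refine and_congr_right fun _ => and_iff_left fun j hj => ?_
  rw [Int.fract_eq_self.2 (hξ z i).1, Int.fract_eq_self.2 (hξ z j).1]
  exact (hξ z i).2 j hj.ne

theorem ae_admissible (a : ℝ≥0) : ∀ᵐ ξ ∂(infinitePi fun _ : ℤ => cellLaw a), Admissible ξ := by
  have hcell : ∀ᵐ c ∂(cellLaw a), ∀ i, c.2 i ∈ Set.Ico (0 : ℝ) 1 ∧ ∀ j, j ≠ i → c.2 j ≠ c.2 i := by
    have hsnd : MeasurePreserving Prod.snd (cellLaw a) posLaw := measurePreserving_snd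
    refine hsnd.quasiMeasurePreserving.ae (p := fun u : ℕ → ℝ =>
      ∀ i, u i ∈ Set.Ico (0 : ℝ) 1 ∧ ∀ j, j ≠ i → u j ≠ u i) ?_
    rw [ae_all_iff]
    intro i
    refine Filter.Eventually.and ?_ ?_
    · refine (measurePreserving_eval_infinitePi (fun _ : ℕ => unif) i).quasiMeasurePreserving.ae
        (p := fun t => t ∈ Set.Ico (0 : ℝ) 1) ?_
      exact ae_restrict_mem measurableSet_Ico
    · rw [ae_all_iff]
      intro j
      by_cases hij : j = i
      · simp [hij]
      · have hmp : MeasurePreserving (fun u : ℕ → ℝ => (u j, u i)) posLaw (unif.prod unif) :=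
          ⟨by fun_prop, infinitePi_map_eval_prod hij⟩
        have hne : ∀ᵐ p ∂(unif.prod unif), p.1 ≠ p.2 := by
          refine (ae_prod_iff_ae_ae ((measurableSet_eq_fun measurable_fst measurable_snd).compl)).2
            (ae_of_all _ fun s => ?_)
          have hs : unif {s} = 0 := by
            rw [unif, restrict_apply (measurableSet_singleton s)]
            exact measure_mono_null Set.inter_subset_left (measure_singleton s)
          filter_upwards [compl_mem_ae_iff.2 hs] with t ht h
          exact ht h.symm
        filter_upwards [hmp.quasiMeasurePreserving.ae hne] with u hu _ using hu
  unfold Admissible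
  rw [ae_all_iff]
  intro z
  exact (measurePreserving_eval_infinitePi (fun _ : ℤ => cellLaw a)
    z).quasiMeasurePreserving.ae hcell

end Config

/-! ### The Poisson property of independent cells -/

section PoissonProperty

open Measure Filter Topology

@[to_additive]
theorem measurable_prod_range {M : Type*} [CommMonoid M] [MeasurableSpace M] [MeasurableMul₂ M]
    {f : ℝ → M} (hf : Measurable f) :
    Measurable fun c : ℕ × (ℕ → ℝ) => ∏ i ∈ Finset.range c.1, f (c.2 i) := by
  refine measurable_from_prod_countable_right fun n => ?_
  change Measurable fun u : ℕ → ℝ => ∏ i ∈ Finset.range n, f (u i)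
  exact Finset.measurable_fun_prod _ fun i _ => hf.comp (measurable_pi_apply i)

theorem integral_prod_infinitePi {ι X : Type*} [MeasurableSpace X] (μ : Measure X)
    [IsProbabilityMeasure μ] (F : Finset ι) {f : ι → X → ℂ} (hf : ∀ i, Measurable (f i)) :
    ∫ x, ∏ i ∈ F, f i (x i) ∂(infinitePi fun _ : ι => μ) = ∏ i ∈ F, ∫ x, f i x ∂μ := by
  have hm : Measurable fun v : F → X => ∏ i : F, f i (v i) :=
    Finset.measurable_fun_prod _ fun i _ => (hf i).comp (measurable_pi_apply i)
  have h := integral_restrict_infinitePi (fun _ : ι => μ) hm.aestronglyMeasurable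
  rw [integral_fintype_prod_eq_prod (fun (i : F) x => f i x),
    Finset.prod_coe_sort F fun i => ∫ x, f i x ∂μ] at h
  rw [← h]
  congr 1
  funext x
  exact (Finset.prod_coe_sort F fun i => f i (x i)).symm

theorem integral_cellLaw_prod (a : ℝ≥0) {g : ℝ → ℂ} (hg : Measurable g) (hg1 : ∀ x, ‖g x‖ ≤ 1) :
    ∫ c, ∏ i ∈ Finset.range c.1, g (c.2 i) ∂(cellLaw a) =
      Complex.exp (a * (∫ t, g t ∂unif - 1)) := by
  have hmeas : Measurable fun c : ℕ × (ℕ → ℝ) => ∏ i ∈ Finset.range c.1, g (c.2 i) :=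
    measurable_prod_range hg
  have hbound : ∀ c : ℕ × (ℕ → ℝ), ‖∏ i ∈ Finset.range c.1, g (c.2 i)‖ ≤ 1 := fun c => by
    rw [norm_prod]
    exact Finset.prod_le_one (fun _ _ => norm_nonneg _) fun _ _ => hg1 _
  have hint : Integrable (fun c : ℕ × (ℕ → ℝ) => ∏ i ∈ Finset.range c.1, g (c.2 i)) (cellLaw a) :=
    Integrable.of_bound hmeas.aestronglyMeasurable 1 (ae_of_all _ hbound)
  have hinner : ∀ n : ℕ, ∫ u, ∏ i ∈ Finset.range n, g (u i) ∂posLaw = (∫ t, g t ∂unif) ^ n := by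
    intro n
    rw [posLaw, integral_prod_infinitePi unif _ fun _ => hg]
    simp
  rw [cellLaw, integral_prod _ hint]
  simp only [hinner]
  rw [integral_poissonMeasure]
  set w := ∫ t, g t ∂unif
  calc ∑' n : ℕ, (Real.exp (-a) * a ^ n / n.factorial) • w ^ n
      = ∑' n : ℕ, (Real.exp (-a) : ℂ) * ((a * w) ^ n / n.factorial) := by
        refine tsum_congr fun n => ?_
        rw [Complex.real_smul]; push_cast; ring
    _ = Real.exp (-a) * Complex.exp (a * w) := by
        rw [tsum_mul_left, (NormedSpace.expSeries_div_hasSum_exp (a * w : ℂ)).tsum_eq,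
          Complex.exp_eq_exp_ℂ]
    _ = Complex.exp (a * (w - 1)) := by
        rw [Complex.ofReal_exp, ← Complex.exp_add]; push_cast; ring_nf

/-- The number of points in `B` among the points of the cells in `F`. -/
noncomputable def cellCount (L : ℝ) (F : Finset ℤ) (B : Set ℝ) (ξ : ℤ → ℕ × (ℕ → ℝ)) : ℕ :=
  ∑ z ∈ F, ∑ i ∈ Finset.range (ξ z).1, B.indicator 1 (cellPoint L z ((ξ z).2 i))

theorem measurable_cellCount (L : ℝ) (F : Finset ℤ) {B : Set ℝ} (hB : MeasurableSet B) :
    Measurable (cellCount L F B) := by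
  refine Finset.measurable_fun_sum _ fun z _ => ?_
  have h := measurable_sum_range (f := fun t => B.indicator (1 : ℝ → ℕ) (cellPoint L z t))
    ((measurable_one.indicator hB).comp (measurable_cellPoint L z))
  exact h.comp (measurable_pi_apply z)

theorem count_cellConfig_eq_cellCount {L : ℝ} (hL : 0 < L) {ξ : ℤ → ℕ × (ℕ → ℝ)}
    (hξ : Admissible ξ) {F : Finset ℤ} {B : Set ℝ} (hB : B ⊆ ⋃ z ∈ F, cell L z) :
    LocFinSet.count B (cellConfig hL ξ) = (cellCount L F B ξ : ℕ∞) := by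
  classical
  rw [count_cellConfig hL hξ]
  have : {p : ℤ × ℕ | p.2 < (ξ p.1).1 ∧ cellPoint L p.1 ((ξ p.1).2 p.2) ∈ B} =
      ((F.sigma fun z => (Finset.range (ξ z).1).filter fun i =>
        cellPoint L z ((ξ z).2 i) ∈ B).map (Equiv.sigmaEquivProd ℤ ℕ).toEmbedding : Finset _) := by
    ext ⟨z, i⟩
    simp only [Set.mem_ofPred_eq, Finset.coe_map, Set.mem_image, Finset.mem_coe, Finset.mem_sigma,
      Finset.mem_filter, Finset.mem_range]
    constructor
    · rintro ⟨h1, h2⟩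
      refine ⟨⟨z, i⟩, ⟨?_, h1, h2⟩, rfl⟩
      obtain ⟨w, hw, hx⟩ := Set.mem_iUnion₂.1 (hB h2)
      rw [mem_cell_iff hL, (mem_cell_iff hL).1 (cellPoint_mem_cell hL z _)] at hx
      exact hx ▸ hw
    · rintro ⟨⟨w, j⟩, ⟨-, h1, h2⟩, h⟩
      obtain ⟨rfl, rfl⟩ := Prod.mk.inj h
      exact ⟨h1, h2⟩
  rw [this, Set.encard_coe_eq_coe_finsetCard, Finset.card_map, Finset.card_sigma]
  congr 1
  refine Finset.sum_congr rfl fun z _ => ?_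
  rw [Finset.card_filter]
  exact Finset.sum_congr rfl fun i _ => by simp [Set.indicator_apply]

/-- The points of a cell are uniformly distributed over it. -/
theorem unif_real_preimage_cellPoint {L : ℝ} (hL : 0 < L) (z : ℤ) {B : Set ℝ}
    (hB : MeasurableSet B) :
    unif.real (cellPoint L z ⁻¹' B) = volume.real (B ∩ cell L z) / L := by
  have hpre : cellPoint L z ⁻¹' B ∩ Set.Ico 0 1 =
      (fun t => L * t) ⁻¹' ((fun x => x + z * L) ⁻¹' (B ∩ cell L z)) := by
    ext t
    simp only [Set.mem_inter_iff, Set.mem_preimage, cell, Set.mem_Ico]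
    constructor
    · rintro ⟨h, ht⟩
      have : cellPoint L z t = L * t + z * L := by
        rw [cellPoint, Int.fract_eq_self.2 ht, add_comm]
      exact ⟨this ▸ h, by nlinarith [ht.1], by nlinarith [ht.2]⟩
    · rintro ⟨h, h1, h2⟩
      have ht : t ∈ Set.Ico (0 : ℝ) 1 := by
        constructor
        · by_contra hneg
          nlinarith [mul_pos_of_neg_of_neg (not_le.1 hneg) (neg_lt_zero.2 hL)]
        · by_contra hge
          nlinarith [mul_le_mul_of_nonneg_left (not_lt.1 hge) hL.le]
      refine ⟨?_, ht⟩
      rwa [cellPoint, Int.fract_eq_self.2 ht, add_comm]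
  rw [measureReal_def, unif, restrict_apply (measurable_cellPoint L z hB), hpre,
    Real.volume_preimage_mul_left hL.ne', measure_preimage_add_right, ENNReal.toReal_mul,
    ENNReal.toReal_ofReal (abs_nonneg _), abs_inv, abs_of_pos hL, measureReal_def,
    div_eq_inv_mul]

/-- The joint characteristic function of the numbers of points in disjoint bounded sets. -/
theorem integral_cexp_cellCount {L : ℝ} (hL : 0 < L) {lam : ℝ} {a : ℝ≥0} (ha : (a : ℝ) = lam * L)
    {ι : Type*} [Fintype ι] {B : ι → Set ℝ} (hB : ∀ j, MeasurableSet (B j))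
    (hd : Pairwise fun i j => Disjoint (B i) (B j)) {F : Finset ℤ}
    (hF : ∀ j, B j ⊆ ⋃ z ∈ F, cell L z) (t : ι → ℝ) :
    ∫ ξ, Complex.exp ((∑ j, t j * (cellCount L F (B j) ξ : ℝ) : ℝ) * Complex.I)
        ∂(infinitePi fun _ : ℤ => cellLaw a) =
      ∏ j, Complex.exp ((lam * volume.real (B j) : ℝ) * (Complex.exp (t j * Complex.I) - 1)) := by
  classical
  -- the weight of a point
  let g : ℝ → ℂ := fun x => Complex.exp ((∑ j, t j * (B j).indicator 1 x : ℝ) * Complex.I)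
  have hgm : Measurable g := by
    refine Complex.measurable_exp.comp (Measurable.mul_const (Complex.measurable_ofReal.comp ?_) _)
    exact Finset.measurable_fun_sum _ fun j _ =>
      (Measurable.indicator measurable_one (hB j)).const_mul _
  have hg1 : ∀ x, ‖g x‖ ≤ 1 := fun x => (Complex.norm_exp_ofReal_mul_I _).le
  have hgval : ∀ x,
      g x = 1 + ∑ j, (B j).indicator (fun _ => Complex.exp (t j * Complex.I) - 1) x := by
    intro x
    by_cases hx : ∃ j, x ∈ B j
    · obtain ⟨j, hj⟩ := hx
      have hne : ∀ k, k ≠ j → x ∉ B k := fun k hk hxk => Set.disjoint_left.1 (hd hk) hxk hj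
      simp only [g]
      rw [Finset.sum_eq_single j (fun k _ hk => by simp [hne k hk]) (by simp),
        Finset.sum_eq_single j (fun k _ hk => by simp [hne k hk]) (by simp)]
      simp [hj]
    · push Not at hx
      simp [g, hx]
  have hpoint : ∀ ξ : ℤ → ℕ × (ℕ → ℝ),
      Complex.exp ((∑ j, t j * (cellCount L F (B j) ξ : ℝ) : ℝ) * Complex.I) =
        ∏ z ∈ F, ∏ i ∈ Finset.range (ξ z).1, g (cellPoint L z ((ξ z).2 i)) := by
    intro ξ
    simp only [g, ← Complex.exp_sum, ← Finset.sum_mul, ← Complex.ofReal_sum]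
    congr 3
    simp only [cellCount, Nat.cast_sum, Finset.mul_sum]
    rw [Finset.sum_comm]
    refine Finset.sum_congr rfl fun z _ => ?_
    rw [Finset.sum_comm]
    refine Finset.sum_congr rfl fun i _ => Finset.sum_congr rfl fun j _ => ?_
    by_cases h : cellPoint L z ((ξ z).2 i) ∈ B j <;> simp [h]
  simp only [hpoint]
  -- the cells are independent
  have hGm : ∀ z : ℤ, Measurable fun c : ℕ × (ℕ → ℝ) =>
      ∏ i ∈ Finset.range c.1, g (cellPoint L z (c.2 i)) := fun z =>
    measurable_prod_range (hgm.comp (measurable_cellPoint L z))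
  rw [integral_prod_infinitePi (cellLaw a) F hGm]
  have hcell : ∀ z : ℤ, ∫ c, ∏ i ∈ Finset.range c.1, g (cellPoint L z (c.2 i)) ∂(cellLaw a) =
      Complex.exp (∑ j, (lam * volume.real (B j ∩ cell L z) : ℝ) *
        (Complex.exp (t j * Complex.I) - 1)) := by
    intro z
    refine (integral_cellLaw_prod a (hgm.comp (measurable_cellPoint L z)) fun x => hg1 _).trans ?_
    congr 1
    have hpre : ∀ j, MeasurableSet (cellPoint L z ⁻¹' B j) := fun j =>
      measurable_cellPoint L z (hB j)
    have hI : ∫ s, (g ∘ cellPoint L z) s ∂unif =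
        1 + ∑ j, (volume.real (B j ∩ cell L z) / L : ℝ) * (Complex.exp (t j * Complex.I) - 1) := by
      have e : ∀ s, (g ∘ cellPoint L z) s = 1 + ∑ j, (cellPoint L z ⁻¹' B j).indicator
          (fun _ => Complex.exp (t j * Complex.I) - 1) s := fun s => hgval _
      simp only [e]
      rw [integral_add (integrable_const _) (integrable_finsetSum _ fun j _ =>
        (integrable_const _).indicator (hpre j)), integral_finsetSum _ fun j _ =>
        (integrable_const _).indicator (hpre j)]
      simp only [integral_const, probReal_univ, one_smul]
      congr 1
      refine Finset.sum_congr rfl fun j _ => ?_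
      rw [integral_indicator_const _ (hpre j), unif_real_preimage_cellPoint hL z (hB j),
        Complex.real_smul]
    rw [hI, add_sub_cancel_left, Finset.mul_sum]
    refine Finset.sum_congr rfl fun j _ => ?_
    rw [← mul_assoc, show (a : ℂ) = ((a : ℝ) : ℂ) from rfl, ha, ← Complex.ofReal_mul]
    congr 2
    field_simp
  simp only [hcell]
  rw [← Complex.exp_sum, ← Complex.exp_sum, Finset.sum_comm]
  congr 1
  refine Finset.sum_congr rfl fun j _ => ?_
  rw [← Finset.sum_mul, ← Complex.ofReal_sum, ← Finset.mul_sum]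
  congr 3
  -- the volumes in the cells add up
  have hdisj : (F : Set ℤ).PairwiseDisjoint fun z => B j ∩ cell L z := by
    intro z _ w _ hzw
    refine Set.disjoint_left.2 fun x hx hx' => hzw ?_
    rw [← (mem_cell_iff hL).1 hx.2, (mem_cell_iff hL).1 hx'.2]
  have hfin : ∀ z : ℤ, volume (B j ∩ cell L z) ≠ ∞ := fun z =>
    measure_ne_top_of_subset Set.inter_subset_right (by simp [cell])
  rw [← measureReal_biUnion_finset hdisj (fun z _ => (hB j).inter (measurableSet_cell L z))
    fun z _ => hfin z]
  congr 1
  rw [← Set.inter_iUnion₂]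
  exact Set.inter_eq_left.2 (hF j)

/-- The Poisson law of mean `c`, as a law on `ℕ∞`. -/
noncomputable def poissonENat (c : ℝ) : Measure ℕ∞ :=
  (poissonMeasure c.toNNReal).map (fun n : ℕ => (n : ℕ∞))

instance (c : ℝ) : IsProbabilityMeasure (poissonENat c) := by
  unfold poissonENat
  exact isProbabilityMeasure_map Measurable.of_discrete.aemeasurable

theorem map_cellCount {L : ℝ} (hL : 0 < L) {lam : ℝ} (hlam : 0 ≤ lam) {a : ℝ≥0}
    (ha : (a : ℝ) = lam * L) {ι : Type*} [Fintype ι] {B : ι → Set ℝ}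
    (hB : ∀ j, MeasurableSet (B j)) (hd : Pairwise fun i j => Disjoint (B i) (B j)) {F : Finset ℤ}
    (hF : ∀ j, B j ⊆ ⋃ z ∈ F, cell L z) :
    (infinitePi fun _ : ℤ => cellLaw a).map (fun ξ j => (cellCount L F (B j) ξ : ℕ∞)) =
      Measure.pi fun j => poissonENat (lam * volume.real (B j)) := by
  set Q := infinitePi fun _ : ℤ => cellLaw a with hQ
  let X : (ℤ → ℕ × (ℕ → ℝ)) → ι → ℝ := fun ξ j => (cellCount L F (B j) ξ : ℝ)
  have hX : Measurable X := measurable_pi_lambda _ fun j =>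
    (Measurable.of_discrete (f := fun n : ℕ => (n : ℝ))).comp (measurable_cellCount L F (hB j))
  have hc : ∀ j, 0 ≤ lam * volume.real (B j) := fun j => mul_nonneg hlam measureReal_nonneg
  let Po : ι → Measure ℝ := fun j =>
    (poissonMeasure (lam * volume.real (B j)).toNNReal).map (fun n : ℕ => (n : ℝ))
  have hPo : ∀ j, IsProbabilityMeasure (Po j) := fun j =>
    isProbabilityMeasure_map Measurable.of_discrete.aemeasurable
  have : IsProbabilityMeasure (Q.map X) := isProbabilityMeasure_map hX.aemeasurable
  have hreal : Q.map X = Measure.pi Po := by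
    rw [← charFun_eq_pi_iff]
    intro t
    rw [map_map (by fun_prop) hX, charFun_apply, integral_map (by fun_prop)
      (Measurable.aestronglyMeasurable (by fun_prop))]
    have h := integral_cexp_cellCount hL ha hB hd hF t.ofLp
    calc _ = _ := ?_
      _ = _ := h
      _ = _ := ?_
    · congr 1
    · refine Finset.prod_congr rfl fun j _ => ?_
      rw [charFun_map_cast_poissonMeasure]
      congr 2
      exact_mod_cast (Real.coe_toNNReal _ (hc j)).symm
  have hg : Measurable fun x : ℝ => ((⌊x⌋₊ : ℕ) : ℕ∞) :=
    Measurable.of_discrete.comp Nat.measurable_floor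
  have hgPo : ∀ j, (Po j).map (fun x : ℝ => ((⌊x⌋₊ : ℕ) : ℕ∞)) =
      poissonENat (lam * volume.real (B j)) := by
    intro j
    rw [map_map hg Measurable.of_discrete, poissonENat]
    congr 1
    funext n
    simp
  have hfin : ∀ j, SigmaFinite ((Po j).map (fun x : ℝ => ((⌊x⌋₊ : ℕ) : ℕ∞))) := fun j => by
    rw [hgPo]; infer_instance
  have h := pi_map_pi (μ := Po) (f := fun _ x => ((⌊x⌋₊ : ℕ) : ℕ∞)) fun j => hg.aemeasurable
  have hgm : Measurable fun (x : ι → ℝ) j => ((⌊x j⌋₊ : ℕ) : ℕ∞) :=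
    measurable_pi_lambda _ fun j => hg.comp (measurable_pi_apply j)
  rw [← hreal, map_map hgm hX] at h
  simp only [hgPo] at h
  rw [← h]
  congr 1
  funext ξ j
  simp [X]

/-- The law of the configuration described by independent cells. -/
noncomputable def cellConfigLaw {L : ℝ} (hL : 0 < L) (a : ℝ≥0) : Measure LocFinSet :=
  (infinitePi fun _ : ℤ => cellLaw a).map (cellConfig hL)

instance {L : ℝ} (hL : 0 < L) (a : ℝ≥0) : IsProbabilityMeasure (cellConfigLaw hL a) :=
  isProbabilityMeasure_map (measurable_cellConfig hL).aemeasurable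

theorem LocFinSet.measurable_counts {ι : Type*} {B : ι → Set ℝ} (hB : ∀ j, MeasurableSet (B j)) :
    Measurable fun (S : LocFinSet) j => LocFinSet.count (B j) S :=
  measurable_pi_lambda _ fun j => LocFinSet.measurable_count (hB j)

theorem map_counts_of_subset {L : ℝ} (hL : 0 < L) {lam : ℝ} (hlam : 0 ≤ lam) {a : ℝ≥0}
    (ha : (a : ℝ) = lam * L) {ι : Type*} [Fintype ι] {B : ι → Set ℝ}
    (hB : ∀ j, MeasurableSet (B j)) (hd : Pairwise fun i j => Disjoint (B i) (B j)) {F : Finset ℤ}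
    (hF : ∀ j, B j ⊆ ⋃ z ∈ F, cell L z) :
    (cellConfigLaw hL a).map (fun S j => LocFinSet.count (B j) S) =
      Measure.pi fun j => poissonENat (lam * volume.real (B j)) := by
  rw [← map_cellCount hL hlam ha hB hd hF, cellConfigLaw,
    map_map (LocFinSet.measurable_counts hB) (measurable_cellConfig hL)]
  refine Measure.map_congr ?_
  filter_upwards [ae_admissible a] with ξ hξ
  funext j
  exact count_cellConfig_eq_cellCount hL hξ (hF j)

theorem continuous_poissonMeasure_finset (A : Finset ℕ) :
    Continuous fun r : ℝ≥0 => poissonMeasure r (A : Set ℕ) := by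
  simp only [← sum_measure_singleton, poissonMeasure_singleton]
  refine continuous_finsetSum _ fun n _ => ENNReal.continuous_ofReal.comp ?_
  fun_prop

theorem continuous_poissonENat_Iic (k : ℕ∞) :
    Continuous fun c : ℝ => poissonENat c (Set.Iic k) := by
  induction k using ENat.recTopCoe with
  | top => simpa using continuous_const
  | coe k =>
    have : ∀ c, poissonENat c (Set.Iic (k : ℕ∞)) =
        poissonMeasure c.toNNReal ((Finset.range (k + 1) : Finset ℕ) : Set ℕ) := by
      intro c
      rw [poissonENat, map_apply Measurable.of_discrete MeasurableSet.of_discrete]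
      congr 1
      ext n
      simp
    simp only [this]
    exact (continuous_poissonMeasure_finset _).comp continuous_real_toNNReal

theorem generateFrom_range_Iic_ENat :
    MeasurableSpace.generateFrom (Set.range (Set.Iic : ℕ∞ → Set ℕ∞)) = ⊤ := by
  refine top_le_iff.1 fun s _ => ?_
  have hI : ∀ k : ℕ∞, MeasurableSet[MeasurableSpace.generateFrom
      (Set.range (Set.Iic : ℕ∞ → Set ℕ∞))] (Set.Iic k) := fun k =>
    MeasurableSpace.measurableSet_generateFrom ⟨k, rfl⟩
  let _ : MeasurableSpace ℕ∞ := MeasurableSpace.generateFrom (Set.range (Set.Iic : ℕ∞ → Set ℕ∞))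
  have hsing : ∀ k : ℕ∞, MeasurableSet ({k} : Set ℕ∞) := by
    intro k
    have : ({k} : Set ℕ∞) = Set.Iic k \ ⋃ j ∈ Set.Iio k, Set.Iic j := by
      ext x
      simp only [Set.mem_singleton_iff, Set.mem_sdiff, Set.mem_Iic, Set.mem_iUnion, Set.mem_Iio,
        not_exists, not_le]
      constructor
      · rintro rfl
        exact ⟨le_rfl, fun j hj => hj⟩
      · rintro ⟨h1, h2⟩
        by_contra hne
        exact lt_irrefl _ (h2 x (lt_of_le_of_ne h1 hne))
    rw [this]
    exact (hI k).diff (MeasurableSet.biUnion (Set.to_countable _) fun j _ => hI j)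
  rw [← Set.biUnion_of_singleton s]
  exact MeasurableSet.biUnion (Set.to_countable _) fun k _ => hsing k

theorem LocFinSet.count_mono {B C : Set ℝ} (h : B ⊆ C) (S : LocFinSet) :
    LocFinSet.count B S ≤ LocFinSet.count C S :=
  Set.encard_le_encard (Set.inter_subset_inter_right _ h)

theorem LocFinSet.count_le_iff_of_monotone {B : Set ℝ} {J : ℕ → Set ℝ} (hJ : Monotone J)
    (hJu : ⋃ n, J n = Set.univ) (S : LocFinSet) (k : ℕ∞) :
    LocFinSet.count B S ≤ k ↔ ∀ n, LocFinSet.count (B ∩ J n) S ≤ k := by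
  refine ⟨fun h n => (LocFinSet.count_mono Set.inter_subset_left S).trans h, fun h => ?_⟩
  by_contra hlt
  rw [not_le] at hlt
  have hk : k ≠ ⊤ := hlt.ne_top
  obtain ⟨T, hTS, hT⟩ := Set.exists_subset_encard_eq (s := S.carrier ∩ B)
    (k := k + 1) (Order.add_one_le_of_lt hlt)
  have hTfin : T.Finite := Set.encard_ne_top_iff.1 (by
    rw [hT]; simpa using hk)
  obtain ⟨n, hn⟩ : ∃ n, T ⊆ J n := by
    have hx : ∀ x, ∃ n, x ∈ J n := fun x => Set.mem_iUnion.1 (hJu ▸ Set.mem_univ x)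
    choose n hn using hx
    exact ⟨hTfin.toFinset.sup n, fun x hxT => hJ (Finset.le_sup (hTfin.mem_toFinset.2 hxT)) (hn x)⟩
  have h1 : T.encard ≤ k := (Set.encard_le_encard (by
    intro x hx
    exact ⟨(hTS hx).1, (hTS hx).2, hn hx⟩)).trans (h n)
  rw [hT] at h1
  exact absurd h1 (not_le.2 (ENat.lt_add_one_iff hk |>.2 le_rfl))

/-- The numbers of points of independent cells in disjoint sets of finite volume are independent and
Poisson distributed: the case of bounded sets passes to the limit. -/
theorem map_counts_cellConfigLaw {L : ℝ} (hL : 0 < L) {lam : ℝ} (hlam : 0 ≤ lam) {a : ℝ≥0}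
    (ha : (a : ℝ) = lam * L) {ι : Type*} [Fintype ι] {B : ι → Set ℝ}
    (hB : ∀ j, MeasurableSet (B j)) (hfin : ∀ j, volume (B j) ≠ ∞)
    (hd : Pairwise fun i j => Disjoint (B i) (B j)) :
    (cellConfigLaw hL a).map (fun S j => LocFinSet.count (B j) S) =
      Measure.pi fun j => poissonENat (lam * volume.real (B j)) := by
  symm
  refine Measure.pi_eq_generateFrom (C := fun _ => Set.range Set.Iic)
    (fun _ => generateFrom_range_Iic_ENat) (fun _ => ?_) (fun j =>
      (nonempty_finiteSpanningSetsIn (poissonENat _)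
        (D := Set.range Set.Iic) ⟨⊤, Set.Iic_top⟩).some) ?_
  · rintro _ ⟨x, rfl⟩ _ ⟨y, rfl⟩ -
    exact ⟨x ⊓ y, Set.Iic_inter_Iic.symm⟩
  intro s hs
  choose k hk using hs
  obtain rfl : (fun j => Set.Iic (k j)) = s := funext hk
  let J : ℕ → Set ℝ := fun n => ⋃ z ∈ Finset.Icc (-n : ℤ) n, cell L z
  have hJm : ∀ n, MeasurableSet (J n) := fun n =>
    Finset.measurableSet_biUnion _ fun z _ => measurableSet_cell L z
  have hJ : Monotone J := fun n n' h => Set.biUnion_subset_biUnion_left fun z hz => by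
    simp only [Finset.coe_Icc, Set.mem_Icc] at hz ⊢
    omega
  have hJu : ⋃ n, J n = Set.univ := by
    refine Set.eq_univ_of_forall fun x => Set.mem_iUnion.2 ⟨⌊x / L⌋.natAbs, ?_⟩
    refine Set.mem_iUnion₂.2 ⟨⌊x / L⌋, ?_, (mem_cell_iff hL).2 rfl⟩
    rw [Finset.mem_Icc]
    omega
  set P := cellConfigLaw hL a with hP
  have hbd : ∀ n, P {S | ∀ j, LocFinSet.count (B j ∩ J n) S ≤ k j} =
      ∏ j, poissonENat (lam * volume.real (B j ∩ J n)) (Set.Iic (k j)) := by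
    intro n
    have h := map_counts_of_subset hL hlam ha (B := fun j => B j ∩ J n)
      (fun j => (hB j).inter (hJm n)) (fun i j hij => (hd hij).mono Set.inter_subset_left
        Set.inter_subset_left) fun j => Set.inter_subset_right
    have h' := congrArg (fun μ => μ (Set.univ.pi fun j => Set.Iic (k j))) h
    simp only [pi_pi] at h'
    rw [map_apply (LocFinSet.measurable_counts fun j => (hB j).inter (hJm n))
      (MeasurableSet.univ_pi fun j => MeasurableSet.of_discrete)] at h'
    rw [← h']
    congr 1
    ext S
    simp [Pi.le_def]
  have hlhs : Tendsto (fun n => P {S | ∀ j, LocFinSet.count (B j ∩ J n) S ≤ k j}) atTop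
      (𝓝 (P {S | ∀ j, LocFinSet.count (B j) S ≤ k j})) := by
    have hset : {S : LocFinSet | ∀ j, LocFinSet.count (B j) S ≤ k j} =
        ⋂ n, {S | ∀ j, LocFinSet.count (B j ∩ J n) S ≤ k j} := by
      ext S
      rw [Set.mem_iInter]
      exact (forall_congr' fun j =>
        LocFinSet.count_le_iff_of_monotone hJ hJu S (k j)).trans forall_comm
    rw [hset]
    refine tendsto_measure_iInter_atTop (fun n => MeasurableSet.nullMeasurableSet ?_) ?_
      ⟨0, measure_ne_top _ _⟩
    · have : {S : LocFinSet | ∀ j, LocFinSet.count (B j ∩ J n) S ≤ k j} =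
          ⋂ j, LocFinSet.count (B j ∩ J n) ⁻¹' Set.Iic (k j) := by ext; simp
      rw [this]
      exact MeasurableSet.iInter fun j =>
        LocFinSet.measurable_count ((hB j).inter (hJm n)) MeasurableSet.of_discrete
    · intro n n' h S hS j
      exact (LocFinSet.count_mono (Set.inter_subset_inter_right _ (hJ h)) S).trans (hS j)
  have hrhs : Tendsto (fun n => ∏ j, poissonENat (lam * volume.real (B j ∩ J n)) (Set.Iic (k j)))
      atTop (𝓝 (∏ j, poissonENat (lam * volume.real (B j)) (Set.Iic (k j)))) := by
    refine ENNReal.tendsto_finsetProd_of_ne_top _ (fun j _ => ?_) fun j _ => measure_ne_top _ _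
    refine ((continuous_poissonENat_Iic (k j)).tendsto _).comp (Tendsto.const_mul lam ?_)
    have h1 := tendsto_measure_iUnion_atTop (μ := volume) (s := fun n => B j ∩ J n)
      fun n n' h => Set.inter_subset_inter_right _ (hJ h)
    rw [← Set.inter_iUnion, hJu, Set.inter_univ] at h1
    exact (ENNReal.tendsto_toReal (hfin j)).comp h1
  have hlim := tendsto_nhds_unique hlhs (by simpa only [hbd] using hrhs)
  rw [← hlim, map_apply (LocFinSet.measurable_counts hB)
    (MeasurableSet.univ_pi fun j => MeasurableSet.of_discrete)]
  congr 1
  ext S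
  simp [Pi.le_def]

/-- Independent cells with Poisson many uniform points form a Poisson process. -/
theorem isPoissonLaw_cellConfigLaw {L : ℝ} (hL : 0 < L) {lam : ℝ} (hlam : 0 ≤ lam) {a : ℝ≥0}
    (ha : (a : ℝ) = lam * L) : IsPoissonLaw lam (cellConfigLaw hL a) where
  isProbabilityMeasure := inferInstance
  map_count B hB hfin := by
    have h := map_counts_cellConfigLaw hL hlam ha (B := fun _ : Unit => B) (fun _ => hB)
      (fun _ => hfin) (fun i j hij => absurd (Subsingleton.elim i j) hij)
    have h' := congrArg (fun μ => μ.map fun x => x ()) h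
    rw [map_map (measurable_pi_apply _) (LocFinSet.measurable_counts fun _ => hB)] at h'
    refine Eq.trans h' ?_
    exact (measurePreserving_eval (fun _ : Unit => poissonENat (lam * volume.real B)) ()).map_eq
  iIndepFun_count n B hB hfin hd := by
    have h := map_counts_cellConfigLaw hL hlam ha hB hfin hd
    rw [iIndepFun_iff_map_fun_eq_pi_map fun i =>
      (LocFinSet.measurable_count (hB i)).aemeasurable, h]
    congr 1
    funext j
    have h' := congrArg (fun μ => μ.map fun x => x j) h
    rw [map_map (measurable_pi_apply _) (LocFinSet.measurable_counts hB),
      (measurePreserving_eval _ j).map_eq] at h'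
    exact h'.symm

end PoissonProperty

/-! ### Uniqueness of the Poisson law -/

section Uniqueness

open Measure

theorem IsPoissonLaw.iIndepFun_counts {lam : ℝ} {μ : Measure LocFinSet} (h : IsPoissonLaw lam μ)
    {ι : Type*} [Finite ι] {B : ι → Set ℝ} (hB : ∀ j, MeasurableSet (B j))
    (hfin : ∀ j, volume (B j) ≠ ∞) (hd : Pairwise fun i j => Disjoint (B i) (B j)) :
    iIndepFun (fun j => LocFinSet.count (B j)) μ := by
  obtain ⟨n, ⟨e⟩⟩ := Finite.exists_equiv_fin ι
  have h1 := h.iIndepFun_count n (fun i => B (e.symm i)) (fun i => hB _) (fun i => hfin _)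
    fun i j hij => hd fun h => hij (e.symm.injective h)
  have h2 := h1.precomp e.injective
  simpa using h2

theorem IsPoissonLaw.map_counts {lam : ℝ} {μ : Measure LocFinSet} (h : IsPoissonLaw lam μ)
    {ι : Type*} [Fintype ι] {B : ι → Set ℝ} (hB : ∀ j, MeasurableSet (B j))
    (hfin : ∀ j, volume (B j) ≠ ∞) (hd : Pairwise fun i j => Disjoint (B i) (B j)) :
    μ.map (fun S j => LocFinSet.count (B j) S) =
      Measure.pi fun j => poissonENat (lam * volume.real (B j)) := by
  have := h.isProbabilityMeasure
  rw [(iIndepFun_iff_map_fun_eq_pi_map fun j =>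
    (LocFinSet.measurable_count (hB j)).aemeasurable).1 (h.iIndepFun_counts hB hfin hd)]
  congr 1
  funext j
  exact h.map_count _ (hB j) (hfin j)

/-- The set of points that lie in exactly those `B j` with `j ∈ T`. -/
def atom {ι : Type*} (B : ι → Set ℝ) (T : Finset ι) : Set ℝ := {x | ∀ j, x ∈ B j ↔ j ∈ T}

theorem measurableSet_atom {ι : Type*} [Finite ι] {B : ι → Set ℝ} (hB : ∀ j, MeasurableSet (B j))
    (T : Finset ι) : MeasurableSet (atom B T) := by
  have : atom B T = ⋂ j, {x | x ∈ B j ↔ j ∈ T} := by ext; simp [atom]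
  rw [this]
  exact MeasurableSet.iInter fun j => measurableSet_setOfPred.2 ((hB j).mem.iff measurable_const)

theorem disjoint_atom {ι : Type*} (B : ι → Set ℝ) {T U : Finset ι} (h : T ≠ U) :
    Disjoint (atom B T) (atom B U) :=
  Set.disjoint_left.2 fun _ hT hU => h (Finset.ext fun j => (hT j).symm.trans (hU j))

theorem count_eq_sum_atom {ι : Type*} [Fintype ι] [DecidableEq ι] (B : ι → Set ℝ) (j : ι)
    (S : LocFinSet) : LocFinSet.count (B j) S =
      ∑ T : {T : Finset ι // T.Nonempty},
        if j ∈ T.1 then LocFinSet.count (atom B T.1) S else 0 := by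
  classical
  rw [← Finset.sum_filter, LocFinSet.count]
  have : S.carrier ∩ B j = ⋃ T ∈ Finset.univ.filter fun T : {T : Finset ι // T.Nonempty} => j ∈ T.1,
      S.carrier ∩ atom B T.1 := by
    ext x
    simp only [Set.mem_inter_iff, Set.mem_iUnion, Finset.mem_filter, Finset.mem_univ, true_and,
      exists_prop]
    constructor
    · rintro ⟨hS, hx⟩
      exact ⟨⟨Finset.univ.filter fun i => x ∈ B i, j, by simpa using hx⟩, by simpa using hx, hS,
        fun i => by simp⟩
    · rintro ⟨T, hj, hS, hx⟩
      exact ⟨hS, (hx j).2 hj⟩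
  have h := (Finset.finite_toSet (Finset.univ.filter
    fun T : {T : Finset ι // T.Nonempty} => j ∈ T.1)).encard_biUnion
    (s := fun T => S.carrier ∩ atom B T.1) fun T _ U _ hTU =>
      ((disjoint_atom B fun h' => hTU (Subtype.ext h')).mono Set.inter_subset_right
        Set.inter_subset_right)
  rw [finsum_mem_coe_finset] at h
  rw [this]
  exact h

/-- A Poisson law determines the joint law of the numbers of points in finitely many sets, disjoint
or not: these numbers are sums of the numbers of points in the atoms of the sets. -/
theorem IsPoissonLaw.map_counts_unique {lam : ℝ} {μ ν : Measure LocFinSet} (hμ : IsPoissonLaw lam μ)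
    (hν : IsPoissonLaw lam ν) {ι : Type*} [Fintype ι] {B : ι → Set ℝ}
    (hB : ∀ j, MeasurableSet (B j)) (hfin : ∀ j, volume (B j) ≠ ∞) :
    μ.map (fun S j => LocFinSet.count (B j) S) = ν.map (fun S j => LocFinSet.count (B j) S) := by
  classical
  have hD : ∀ T : {T : Finset ι // T.Nonempty}, MeasurableSet (atom B T.1) := fun T =>
    measurableSet_atom hB T.1
  have hDfin : ∀ T : {T : Finset ι // T.Nonempty}, volume (atom B T.1) ≠ ∞ := fun ⟨T, j, hj⟩ =>
    measure_ne_top_of_subset (fun x hx => (hx j).2 hj) (hfin j)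
  have hDd : Pairwise fun T U : {T : Finset ι // T.Nonempty} =>
      Disjoint (atom B T.1) (atom B U.1) := fun T U h =>
    disjoint_atom B fun h' => h (Subtype.ext h')
  let g : ({T : Finset ι // T.Nonempty} → ℕ∞) → ι → ℕ∞ := fun v j =>
    ∑ T : {T : Finset ι // T.Nonempty}, if j ∈ T.1 then v T else 0
  have hg : Measurable g := by
    refine measurable_pi_lambda _ fun j => Finset.measurable_fun_sum _ fun T _ => ?_
    split_ifs
    · exact measurable_pi_apply T
    · exact measurable_const
  have hcomp : (fun (S : LocFinSet) j => LocFinSet.count (B j) S) =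
      g ∘ fun S T => LocFinSet.count (atom B T.1) S := by
    funext S j
    exact count_eq_sum_atom B j S
  rw [hcomp, ← map_map hg (LocFinSet.measurable_counts hD),
    ← map_map hg (LocFinSet.measurable_counts hD), hμ.map_counts hD hDfin hDd,
    hν.map_counts hD hDfin hDd]

/-- There is only one Poisson law of a given intensity: the counts in the Borel sets of finite
volume generate the σ-algebra, because the count in an arbitrary Borel set is a supremum of such
counts. -/
theorem IsPoissonLaw.unique {lam : ℝ} {μ ν : Measure LocFinSet} (hμ : IsPoissonLaw lam μ)
    (hν : IsPoissonLaw lam ν) : μ = ν := by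
  have := hμ.isProbabilityMeasure
  have := hν.isProbabilityMeasure
  let 𝓑 := {B : Set ℝ // MeasurableSet B ∧ volume B ≠ ∞}
  let Φ : LocFinSet → 𝓑 → ℕ∞ := fun S B => LocFinSet.count B.1 S
  have hΦ : Measurable Φ := LocFinSet.measurable_counts fun B => B.2.1
  have hmap : μ.map Φ = ν.map Φ := by
    have h : IsProjectiveLimit (μ.map Φ) fun I => (ν.map Φ).map I.restrict := by
      intro I
      dsimp only
      rw [map_map (Finset.measurable_restrict I) hΦ, map_map (Finset.measurable_restrict I) hΦ]
      exact hμ.map_counts_unique hν (B := fun B : I => B.1.1) (fun B => B.1.2.1) fun B => B.1.2.2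
    have (I : Finset 𝓑) : IsFiniteMeasure ((ν.map Φ).map I.restrict) := by
      have := isProbabilityMeasure_map (μ := ν) hΦ.aemeasurable
      infer_instance
    exact h.unique fun I => rfl
  have hle : (inferInstance : MeasurableSpace LocFinSet) ≤
      MeasurableSpace.comap Φ inferInstance := by
    refine iSup_le fun B => measurable_iff_comap_le.1 ?_
    rw [← generateFrom_range_Iic_ENat]
    refine @measurable_generateFrom _ _ (MeasurableSpace.comap Φ inferInstance) _ _ ?_
    rintro _ ⟨k, rfl⟩
    let J : ℕ → Set ℝ := fun n => Set.Icc (-n) n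
    have hJ : Monotone J := fun n n' h => Set.Icc_subset_Icc (by simpa using h) (by simpa using h)
    have hJu : ⋃ n, J n = Set.univ := by
      refine Set.eq_univ_of_forall fun x => ?_
      obtain ⟨n, hn⟩ := exists_nat_ge |x|
      exact Set.mem_iUnion.2 ⟨n, abs_le.1 hn⟩
    let C : ℕ → 𝓑 := fun n => ⟨B.1 ∩ J n, B.2.inter measurableSet_Icc,
      measure_ne_top_of_subset Set.inter_subset_right (by simp [J])⟩
    refine ⟨⋂ n, (fun v => v (C n)) ⁻¹' Set.Iic k, MeasurableSet.iInter fun n =>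
      measurable_pi_apply (C n) MeasurableSet.of_discrete, ?_⟩
    ext S
    simp only [Set.preimage_iInter, Set.mem_iInter, Set.mem_preimage, Set.mem_Iic]
    exact (LocFinSet.count_le_iff_of_monotone hJ hJu S k).symm
  refine Measure.ext fun A hA => ?_
  obtain ⟨E, hE, rfl⟩ := hle A hA
  rw [← map_apply hΦ hE, hmap, map_apply hΦ hE]

end Uniqueness

/-! ### The thickening and its lack of equivariance -/

section Thickening

open Measure

/-- A locally finite set is closed, so that its points are detected by counts in small intervals. -/
theorem LocFinSet.mem_iff_forall_count_ne_zero (S : LocFinSet) (x : ℝ) :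
    x ∈ S.carrier ↔
      ∀ n : ℕ, LocFinSet.count {y | ⌊y * (n + 1)⌋ = ⌊x * (n + 1)⌋} S ≠ 0 := by
  simp only [LocFinSet.count, Set.encard_ne_zero]
  refine ⟨fun hx n => ⟨x, hx, rfl⟩, fun h => ?_⟩
  by_contra hx
  have hcl : IsClosed (S.carrier ∩ Metric.closedBall x 1) :=
    (S.finite_inter _ (isCompact_closedBall x 1)).isClosed
  obtain ⟨ε, hε, hball⟩ := Metric.isOpen_iff.1 hcl.isOpen_compl x fun h => hx h.1
  obtain ⟨n, hn⟩ := exists_nat_one_div_lt (lt_min hε one_pos)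
  obtain ⟨y, hyS, hy⟩ := h n
  have hn0 : (0 : ℝ) < n + 1 := by positivity
  have hd : |y - x| < 1 / (n + 1) := by
    have h1 := Int.abs_sub_lt_one_of_floor_eq_floor hy
    rw [← sub_mul, abs_mul, abs_of_pos hn0] at h1
    rwa [lt_div_iff₀ hn0]
  have hd' : dist y x < min ε 1 := (Real.dist_eq y x).trans_lt (hd.trans hn)
  exact hball (Metric.mem_ball.2 (hd'.trans_le (min_le_left _ _)))
    ⟨hyS, Metric.mem_closedBall.2 (hd'.le.trans (min_le_right _ _))⟩

theorem measurableSet_mem_carrier {Ω : Type*} [MeasurableSpace Ω] {S : Ω → LocFinSet}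
    (hS : Measurable S) {x : Ω → ℝ} (hx : Measurable x) :
    MeasurableSet {ω | x ω ∈ (S ω).carrier} := by
  have : {ω | x ω ∈ (S ω).carrier} = ⋂ n : ℕ, ⋃ k : ℤ, {ω | ⌊x ω * (n + 1)⌋ = k} ∩
      {ω | LocFinSet.count {y | ⌊y * (n + 1)⌋ = k} (S ω) ≠ 0} := by
    ext ω
    simp [LocFinSet.mem_iff_forall_count_ne_zero]
  rw [this]
  refine MeasurableSet.iInter fun n => MeasurableSet.iUnion fun k => MeasurableSet.inter ?_ ?_
  · exact (Int.measurable_floor.comp (hx.mul_const _)) (measurableSet_singleton k)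
  · have hB : MeasurableSet {y : ℝ | ⌊y * (n + 1)⌋ = k} :=
      (Int.measurable_floor.comp (measurable_id.mul_const _)) (measurableSet_singleton k)
    exact ((LocFinSet.measurable_count hB).comp hS)
      (MeasurableSet.of_discrete (s := ({0} : Set ℕ∞)ᶜ))

/-- The points of the second configuration that lie outside the first one are counted separately. -/
theorem measurable_union_config {L : ℝ} (hL : 0 < L) {Ω : Type*} [MeasurableSpace Ω]
    {S : Ω → LocFinSet} (hS : Measurable S) {lo hi : Ω → ℤ → ℕ} {u : Ω → ℤ → ℕ → ℝ}
    (hlo : Measurable lo) (hhi : Measurable hi) (hu : Measurable u) :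
    Measurable fun ω => S ω ∪ config hL (lo ω) (hi ω) (u ω) := by
  refine LocFinSet.measurable_iff.2 fun B hB => ?_
  have hcount : ∀ ω, LocFinSet.count B (S ω ∪ config hL (lo ω) (hi ω) (u ω)) =
      LocFinSet.count B (S ω) +
        LocFinSet.count (B \ (S ω).carrier) (config hL (lo ω) (hi ω) (u ω)) := by
    intro ω
    rw [LocFinSet.count, LocFinSet.count, LocFinSet.count, ← Set.encard_union_eq]
    · congr 1
      ext x
      change (x ∈ _ ∨ x ∈ _) ∧ _ ↔ _
      simp only [Set.mem_union, Set.mem_inter_iff, Set.mem_sdiff]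
      tauto
    · exact Set.disjoint_left.2 fun x hx hx' => hx'.2.2 hx.1
  simp only [hcount]
  refine Measurable.add ((LocFinSet.measurable_count hB).comp hS) ?_
  simp only [count_config]
  refine measurable_encard.comp (measurable_set_iff.2 fun p => ?_)
  have hui : ∀ i, Measurable fun ω => u ω p.1 i := fun i =>
    (measurable_pi_apply i).comp ((measurable_pi_apply p.1).comp hu)
  have hl : Measurable fun ω => lo ω p.1 := (measurable_pi_apply p.1).comp hlo
  have hh : Measurable fun ω => hi ω p.1 := (measurable_pi_apply p.1).comp hhi
  have hc := (measurable_cellPoint L p.1).comp (hui p.2)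
  refine Measurable.and ?_ (Measurable.and ?_ (Measurable.and (Measurable.and ?_ ?_) ?_))
  · exact (measurableSet_le hl measurable_const).mem
  · exact (measurableSet_lt measurable_const hh).mem
  · exact (hc hB).mem
  · exact (measurableSet_mem_carrier hS hc).compl.mem
  · refine Measurable.forall fun j => Measurable.imp ?_ (Measurable.imp measurable_const ?_)
    · exact (measurableSet_le hl measurable_const).mem
    · exact (measurableSet_eq_fun (measurable_fract.comp (hui _))
        (measurable_fract.comp (hui _))).compl.mem

/-- The numbers of points in the cells. -/
noncomputable def cellNumbers (L : ℝ) (S : LocFinSet) (z : ℤ) : ℕ :=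
  (LocFinSet.count (cell L z) S).toNat

theorem measurable_cellNumbers (L : ℝ) : Measurable (cellNumbers L) :=
  measurable_pi_lambda _ fun z =>
    Measurable.of_discrete.comp (LocFinSet.measurable_count (measurableSet_cell L z))

theorem cellNumbers_cellConfig {L : ℝ} (hL : 0 < L) {ξ : ℤ → ℕ × (ℕ → ℝ)} (hξ : Admissible ξ) :
    cellNumbers L (cellConfig hL ξ) = fun z => (ξ z).1 := by
  funext z
  have : {p : ℤ × ℕ | p.2 < (ξ p.1).1 ∧ cellPoint L p.1 ((ξ p.1).2 p.2) ∈ cell L z} =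
      ((Finset.range (ξ z).1).map ⟨Prod.mk z, Prod.mk_right_injective z⟩ : Finset (ℤ × ℕ)) := by
    ext ⟨w, i⟩
    have hw : cellPoint L w ((ξ w).2 i) ∈ cell L z ↔ z = w := by
      rw [mem_cell_iff hL, (mem_cell_iff hL).1 (cellPoint_mem_cell hL w _), eq_comm]
    simp only [Set.mem_ofPred_eq, hw, Finset.coe_map, Set.mem_image, Finset.mem_coe,
      Finset.mem_range, Function.Embedding.coeFn_mk, Prod.mk.injEq]
    constructor
    · rintro ⟨h, rfl⟩
      exact ⟨i, h, rfl, rfl⟩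
    · rintro ⟨_, h, rfl, rfl⟩
      exact ⟨h, rfl⟩
  rw [cellNumbers, count_cellConfig hL hξ, this, Set.encard_coe_eq_coe_finsetCard]
  simp

/-- The added points: `R n z` points in each cell `z`, at the positions `P n z`, where `n` lists the
numbers of points in all cells. The positions are indexed from `n z` onwards, as continuations of
the positions of the points already present. -/
noncomputable def addedPoints {L : ℝ} (hL : 0 < L) (R : (ℤ → ℕ) → ℤ → ℕ)
    (P : (ℤ → ℕ) → ℤ → ℕ → ℝ) (S : LocFinSet) : LocFinSet :=
  config hL (cellNumbers L S) (cellNumbers L S + R (cellNumbers L S)) (P (cellNumbers L S))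

theorem cellConfig_union_addedPoints {L : ℝ} (hL : 0 < L) (R : (ℤ → ℕ) → ℤ → ℕ)
    (P : (ℤ → ℕ) → ℤ → ℕ → ℝ) {ξ : ℤ → ℕ × (ℕ → ℝ)} (hξ : Admissible ξ) :
    cellConfig hL ξ ∪ addedPoints hL R P (cellConfig hL ξ) =
      cellConfig hL fun z => ((ξ z).1 + R (fun z => (ξ z).1) z,
        splice (ξ z).1 (ξ z).2 (P (fun z => (ξ z).1) z)) := by
  rw [addedPoints, cellNumbers_cellConfig hL hξ]
  refine LocFinSet.ext (Set.ext fun x => ?_)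
  change (_ ∨ _) ↔ _
  constructor
  · rintro (⟨z, i, -, h, hx⟩ | ⟨z, i, h1, h2, hx⟩)
    · refine ⟨z, i, Nat.zero_le _, Nat.lt_add_right _ h, ?_⟩
      simpa only [splice, if_pos h] using hx
    · refine ⟨z, i, Nat.zero_le _, h2, ?_⟩
      simpa only [splice, if_neg (not_lt.2 h1)] using hx
  · rintro ⟨z, i, -, h, hx⟩
    by_cases hi : i < (ξ z).1
    · exact Or.inl ⟨z, i, Nat.zero_le _, hi, by simpa only [splice, if_pos hi] using hx⟩
    · exact Or.inr ⟨z, i, not_lt.1 hi, h, by simpa only [splice, if_neg hi] using hx⟩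

theorem isThickening_addedPoints {L : ℝ} (hL : 0 < L) {lam lam' : ℝ} (hlam : 0 ≤ lam)
    (hlam' : 0 ≤ lam') {a a' : ℝ≥0} (ha : (a : ℝ) = lam * L) (ha' : (a' : ℝ) = lam' * L)
    {R : (ℤ → ℕ) → ℤ → ℕ} {P : (ℤ → ℕ) → ℤ → ℕ → ℝ} (hR : Measurable R) (hP : Measurable P)
    (h : (infinitePi fun _ : ℤ => cellLaw a).map (fun ξ z => ((ξ z).1 + R (fun z => (ξ z).1) z,
      splice (ξ z).1 (ξ z).2 (P (fun z => (ξ z).1) z))) = infinitePi fun _ : ℤ => cellLaw a') :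
    IsThickening lam lam' (addedPoints hL R P) := by
  have hN := measurable_cellNumbers L
  have hhi : Measurable fun S => cellNumbers L S + R (cellNumbers L S) :=
    hN.add (hR.comp hN)
  have hunion : Measurable fun S => S ∪ addedPoints hL R P S :=
    measurable_union_config hL measurable_id hN hhi (hP.comp hN)
  refine ⟨measurable_config hL hN hhi (hP.comp hN), fun μ hμ => ?_⟩
  rw [hμ.unique (isPoissonLaw_cellConfigLaw hL hlam ha)]
  suffices hmap : (cellConfigLaw hL a).map (fun S => S ∪ addedPoints hL R P S) =
      cellConfigLaw hL a' by
    rw [hmap]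
    exact isPoissonLaw_cellConfigLaw hL hlam' ha'
  rw [cellConfigLaw, map_map hunion (measurable_cellConfig hL), cellConfigLaw, ← h,
    AEMeasurable.map_map_of_aemeasurable (measurable_cellConfig hL).aemeasurable
      (aemeasurable_of_map_neZero (by rw [h]; infer_instance))]
  refine Measure.map_congr ?_
  filter_upwards [ae_admissible a] with ξ hξ
  exact cellConfig_union_addedPoints hL R P hξ

theorem IsPoissonLaw.intensity_unique {lam lam' : ℝ} (hlam : 0 ≤ lam) (hlam' : 0 ≤ lam')
    {μ : Measure LocFinSet} (h : IsPoissonLaw lam μ) (h' : IsPoissonLaw lam' μ) : lam = lam' := by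
  have hmass : ∀ {c : ℝ}, 0 ≤ c → IsPoissonLaw c μ →
      μ.map (LocFinSet.count (Set.Ico 0 1)) {0} = ENNReal.ofReal (Real.exp (-c)) := by
    intro c hc hμ
    rw [hμ.map_count _ measurableSet_Ico (by simp),
      map_apply Measurable.of_discrete MeasurableSet.of_discrete]
    have : (fun n : ℕ => (n : ℕ∞)) ⁻¹' {0} = {0} := by ext; simp
    rw [this, poissonMeasure_singleton]
    simp [hc]
  have heq := (hmass hlam h).symm.trans (hmass hlam' h')
  rw [ENNReal.ofReal_eq_ofReal_iff (Real.exp_nonneg _) (Real.exp_nonneg _), Real.exp_eq_exp] at heq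
  exact neg_injective heq

/-- The addition of points is not equivariant if it does anything at all. A configuration with all
its points well inside the cells can be moved a little without changing the numbers of points in the
cells, hence without moving the added points: these cannot follow the shift. -/
theorem not_isEquivariant_addedPoints {L : ℝ} (hL : 0 < L) (R : (ℤ → ℕ) → ℤ → ℕ)
    (P : (ℤ → ℕ) → ℤ → ℕ → ℝ) {S : LocFinSet} {x : ℝ} (hx : x ∈ (addedPoints hL R P S).carrier) :
    ¬ IsEquivariant (addedPoints hL R P) := by
  intro heq
  -- as many points as `S` has in every cell, but in the left half of the cell, moved by `s L`
  let ξ : ℝ → ℤ → ℕ × (ℕ → ℝ) := fun s z => (cellNumbers L S z, fun i => 1 / (4 * (i + 1)) + s)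
  have hmem : ∀ s ∈ Set.Icc (0 : ℝ) (1 / 2), ∀ i : ℕ,
      1 / (4 * ((i : ℝ) + 1)) + s ∈ Set.Ico (0 : ℝ) 1 := by
    intro s hs i
    have h1 : 1 / (4 * ((i : ℝ) + 1)) ≤ 1 / 4 :=
      one_div_le_one_div_of_le (by norm_num) (by linarith [Nat.cast_nonneg (α := ℝ) i])
    have h0 : 0 ≤ 1 / (4 * ((i : ℝ) + 1)) := by positivity
    exact ⟨by linarith [hs.1], by linarith [hs.2]⟩
  have hadm : ∀ s ∈ Set.Icc (0 : ℝ) (1 / 2), Admissible (ξ s) := by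
    refine fun s hs z i => ⟨hmem s hs i, fun j hj h => hj ?_⟩
    have h' : 1 / (4 * ((j : ℝ) + 1)) = 1 / (4 * ((i : ℝ) + 1)) := add_right_cancel h
    rw [one_div, one_div, inv_inj] at h'
    exact_mod_cast (by linarith : (j : ℝ) = i)
  have hadded : ∀ s ∈ Set.Icc (0 : ℝ) (1 / 2),
      addedPoints hL R P (cellConfig hL (ξ s)) = addedPoints hL R P S := by
    intro s hs
    rw [addedPoints, cellNumbers_cellConfig hL (hadm s hs), addedPoints]
  have h0 : (0 : ℝ) ∈ Set.Icc (0 : ℝ) (1 / 2) := by norm_num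
  have hpt : ∀ s ∈ Set.Icc (0 : ℝ) (1 / 2), ∀ z i,
      cellPoint L z ((ξ s z).2 i) = cellPoint L z ((ξ 0 z).2 i) + s * L := by
    intro s hs z i
    rw [cellPoint, cellPoint, Int.fract_eq_self.2 (hmem s hs i), Int.fract_eq_self.2 (hmem 0 h0 i)]
    ring
  have hshift : ∀ s ∈ Set.Icc (0 : ℝ) (1 / 2),
      (cellConfig hL (ξ 0)).shift (s * L) = cellConfig hL (ξ s) := by
    intro s hs
    refine LocFinSet.ext (Set.ext fun y => ⟨?_, ?_⟩)
    · rintro ⟨_, ⟨z, i, h1, h2, rfl⟩, rfl⟩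
      exact ⟨z, i, h1, h2, hpt s hs z i⟩
    · rintro ⟨z, i, h1, h2, rfl⟩
      exact ⟨_, ⟨z, i, h1, h2, rfl⟩, (hpt s hs z i).symm⟩
  -- an added point `x` would have to be present at all its translates
  have hsub : Set.Icc x (x + L / 2) ⊆ (addedPoints hL R P S).carrier ∩ Set.Icc x (x + L / 2) := by
    refine fun y hy => ⟨?_, hy⟩
    have hs : (y - x) / L ∈ Set.Icc (0 : ℝ) (1 / 2) := by
      refine ⟨div_nonneg (by linarith [hy.1]) hL.le, ?_⟩
      rw [div_le_iff₀ hL]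
      linarith [hy.2]
    have h := heq ((y - x) / L * L) (cellConfig hL (ξ 0))
    rw [hshift _ hs, hadded _ hs, hadded _ h0, div_mul_cancel₀ _ hL.ne'] at h
    rw [h]
    exact ⟨x, hx, by ring⟩
  exact Set.Icc_infinite (by linarith)
    (((addedPoints hL R P S).finite_inter _ isCompact_Icc).subset hsub)

end Thickening

theorem theorem2 (lam lam' : ℝ) (hlam : 0 < lam) (hlt : lam < lam') :
    ∃ f : LocFinSet → LocFinSet, IsThickening lam lam' f ∧ ¬ IsEquivariant f := by
  -- cells so long that at least two points are to be added to each on average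
  obtain ⟨m, hm⟩ := exists_nat_ge (2 * lam / (lam' - lam))
  have hdiff : 0 < lam' - lam := sub_pos.2 hlt
  have hL : 0 < ((m : ℝ) + 2) / lam := by positivity
  set L : ℝ := ((m : ℝ) + 2) / lam with hLdef
  have ha : (((m : ℝ≥0) + 2 : ℝ≥0) : ℝ) = lam * L := by
    rw [hLdef]; push_cast; field_simp
  have hr : (2 : ℝ) ≤ (lam' - lam) * L := by
    rw [div_le_iff₀ hdiff] at hm
    rw [hLdef, ← mul_div_assoc, le_div_iff₀ hlam]
    nlinarith
  let r : ℝ≥0 := ⟨(lam' - lam) * L, by positivity⟩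
  have ha' : (((m : ℝ≥0) + 2 + r : ℝ≥0) : ℝ) = lam' * L := by
    rw [NNReal.coe_add, ha]
    change lam * L + (lam' - lam) * L = lam' * L
    ring
  obtain ⟨R, P, hR, hP, hmap⟩ := exists_thickenCells m (r := r) (by exact_mod_cast hr)
  have hthick : IsThickening lam lam' (addedPoints hL R P) :=
    isThickening_addedPoints hL hlam.le (hlam.trans hlt).le ha ha' hR hP hmap
  refine ⟨addedPoints hL R P, hthick, ?_⟩
  -- some configuration receives points, as otherwise the intensity would not change
  obtain ⟨S, x, hx⟩ : ∃ S x, x ∈ (addedPoints hL R P S).carrier := by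
    by_contra! hempty
    have hid : (fun S => S ∪ addedPoints hL R P S) = id := by
      funext S
      refine LocFinSet.ext (Set.ext fun x => ?_)
      change (_ ∨ _) ↔ _
      exact or_iff_left (hempty S x)
    have hμ := isPoissonLaw_cellConfigLaw hL hlam.le ha
    have hμ' := hthick.2 _ hμ
    rw [hid, Measure.map_id] at hμ'
    exact hlt.ne (hμ.intensity_unique hlam.le (hlam.trans hlt).le hμ')
  exact not_isEquivariant_addedPoints hL R P hx
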